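/- Let $n\ge 1$ and let $F$ be a set of $n$ white ($\circ$) and $n$ black ($\bullet$) points in the plane, no three on a line. A BR-matching of $F$ is a set of $n$ pairwise non-crossing segments that match each white point of $F$ with exactly one black point and vice versa; segments are directed from the white to the black end, and $g(A)$ denotes the directed line containing $A$. Removing the inner points of $A$ from $g(A)$ leaves two closed outer rays, the $\circ$-ray and the $\bullet$-ray, named after the end of $A$ they contain. A chromatic cut of a BR-matching is a line that crosses two of its segments whose $\bullet$-ends lie on different sides of the line. A BR-matching is circular if it has no chromatic cut and all points of $F$ on the boundary of the convex hull of $F$ have the same color. Write $A\triangleleft B$ if $B$ lies strictly right of $g(A)$ and $A$ lies strictly left of $g(B)$. Consider the following patterns of segments: (a) an outer ray of one segment crosses another segment; (b) the $\circ$-ray of one segment crosses the $\bullet$-ray of another, or the two segments are antiparallel (parallel supporting lines with opposite directions); (c) a $3$-star: three segments whose outer rays of one and the same color pairwise cross, such that each of the three supporting lines strictly separates the other two segments. Let $M$ be a BR-matching of $F$. Then the following conditions are equivalent: 1. $M$ is a circular matching. 2. $\triangleleft$ is total on $M$ (any two different segments are comparable) but is not a strict linear order on $M$. 3. $M$ contains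 neither pattern (a) nor pattern (b), but some three segments of $M$ form a $3$-star. Furthermore, if these conditions hold, then: (p1) For every $B\in M$ the sets $M_B^L=\{X\in M: X\triangleleft B\}$ and $M_B^R=\{X\in M: B\triangleleft X\}$ are non-empty, $\triangleleft$ is a strict linear order on $M_B^L\cup\{B\}$ and on $M_B^R$, and the maximum $C_m$ of $M_B^R=\{C_1\triangleleft\dots\triangleleft C_m\}$ and the minimum $A_1$ of $M_B^L=\{A_1\triangleleft\dots\triangleleft A_k\}$ satisfy $C_m\triangleleft A_1$. The ternary relation $[X,Y,Z]$ on $M$, meaning that $X,Y,Z$ or $Y,Z,X$ or $Z,X,Y$ appear in this order in the sequence $B,C_1,\dots,C_m,A_1,\dots,A_k$, is a (strict, total) circular order on $M$, and it does not depend on the choice of $B$. (p2) There are two BR-matchings $M'$ and $M''$ of $F$ such that no two of $M,M',M''$ have a segment in common and such that each of $M\cup M'$ and $M\cup M''$ is non-crossing (i.e. $M'$ and $M''$ are compatible with $M$). -/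

import Mathlib

/-- The Euclidean plane. -/
abbrev Plane : Type := EuclideanSpace ℝ (Fin 2)

/-- Orientation determinant of `p, q, r`: positive (negative) iff `r` lies strictly left (right) of
the line through `p` and `q` directed from `p` to `q`, zero iff `r` lies on that line. -/
def orient (p q r : Plane) : ℝ :=
  (q 0 - p 0) * (r 1 - p 1) - (q 1 - p 1) * (r 0 - p 0)

/-- A bichromatic `(n+n)` point set: `n` white and `n` black points in the plane, no three points on
a line. -/
structure BichromaticSet (n : ℕ) where
  white : Finset Plane
  black : Finset Plane
  disjoint : Disjoint white black
  card_white : white.card = n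
  card_black : black.card = n
  general_position : ∀ p q r : Plane, p ∈ (white : Set Plane) ∪ black →
    q ∈ (white : Set Plane) ∪ black → r ∈ (white : Set Plane) ∪ black →
    p ≠ q → q ≠ r → p ≠ r → ¬ Collinear ℝ {p, q, r}

/-- The set of all `2n` points. -/
def BichromaticSet.points {n : ℕ} (F : BichromaticSet n) : Set Plane :=
  (F.white : Set Plane) ∪ F.black

/-- A bichromatic segment, directed from its white end to its black end. -/
@[ext] structure BWSegment where
  white : Plane
  black : Plane

namespace BWSegment

/-- The white outer ray of the supporting line. -/
def whiteRay (A : BWSegment) : Set Plane :=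
  {x | ∃ t : ℝ, 0 ≤ t ∧ x = A.white + t • (A.white - A.black)}

/-- The black outer ray of the supporting line. -/
def blackRay (A : BWSegment) : Set Plane :=
  {x | ∃ t : ℝ, 0 ≤ t ∧ x = A.black + t • (A.black - A.white)}

/-- `X` lies strictly right of the directed supporting line of `A`. -/
def LiesRightOf (X A : BWSegment) : Prop :=
  orient A.white A.black X.white < 0 ∧ orient A.white A.black X.black < 0

/-- `X` lies strictly left of the directed supporting line of `A`. -/
def LiesLeftOf (X A : BWSegment) : Prop :=
  0 < orient A.white A.black X.white ∧ 0 < orient A.white A.black X.black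

/-- The sidedness relation `A ◁ B`. -/
def Sided (A B : BWSegment) : Prop :=
  B.LiesRightOf A ∧ A.LiesLeftOf B

/-- The supporting lines do not cross and are oppositely directed. -/
def Antiparallel (A B : BWSegment) : Prop :=
  ∃ k : ℝ, k < 0 ∧ B.black - B.white = k • (A.black - A.white)

/-- Pattern (a): an outer ray of `A` crosses the segment `B`. -/
def PatternA (A B : BWSegment) : Prop :=
  ((A.whiteRay ∪ A.blackRay) ∩ segment ℝ B.white B.black).Nonempty

/-- Pattern (b): the white outer ray of `A` crosses the black outer ray of `B`, with antiparallel
segments as a special case. -/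
def PatternB (A B : BWSegment) : Prop :=
  (A.whiteRay ∩ B.blackRay).Nonempty ∨ A.Antiparallel B

/-- The supporting line of `C` separates the segments `A` and `B`. -/
def Separates (C A B : BWSegment) : Prop :=
  (A.LiesLeftOf C ∧ B.LiesRightOf C) ∨ (A.LiesRightOf C ∧ B.LiesLeftOf C)

/-- Pattern (c), the `3`-star: the outer rays of one and the same color pairwise cross, and each of
the three supporting lines separates the other two segments. -/
def ThreeStar (A B C : BWSegment) : Prop :=
  (((A.whiteRay ∩ B.whiteRay).Nonempty ∧ (B.whiteRay ∩ C.whiteRay).Nonempty ∧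
      (C.whiteRay ∩ A.whiteRay).Nonempty) ∨
    ((A.blackRay ∩ B.blackRay).Nonempty ∧ (B.blackRay ∩ C.blackRay).Nonempty ∧
      (C.blackRay ∩ A.blackRay).Nonempty)) ∧
  A.Separates B C ∧ B.Separates C A ∧ C.Separates A B

end BWSegment

/-- No two different segments of the set cross, i.e. have a common inner point. -/
def NonCrossing (S : Set BWSegment) : Prop :=
  S.Pairwise fun A B => Disjoint (openSegment ℝ A.white A.black) (openSegment ℝ B.white B.black)

/-- `M` is a perfect non-crossing straight-line matching of the white points with the black ones. -/
structure IsBRMatching {n : ℕ} (F : BichromaticSet n) (M : Set BWSegment) : Prop where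
  white_mem : ∀ A ∈ M, A.white ∈ F.white
  black_mem : ∀ A ∈ M, A.black ∈ F.black
  white_unique : ∀ p ∈ F.white, ∃! A, A ∈ M ∧ A.white = p
  black_unique : ∀ p ∈ F.black, ∃! A, A ∈ M ∧ A.black = p
  nonCrossing : NonCrossing M

/-- Two matchings are compatible if their union is non-crossing. -/
def Compatible (M M' : Set BWSegment) : Prop := NonCrossing (M ∪ M')

/-- The line through `p ≠ q` crosses the segment `A`. -/
def LineCrosses (p q : Plane) (A : BWSegment) : Prop :=
  orient p q A.white * orient p q A.black < 0

/-- There is a line that crosses two segments of `M` whose black ends are on different sides. -/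
def HasChromaticCut (M : Set BWSegment) : Prop :=
  ∃ p q : Plane, p ≠ q ∧ ∃ A ∈ M, ∃ B ∈ M, LineCrosses p q A ∧ LineCrosses p q B ∧
    orient p q A.black * orient p q B.black < 0

/-- A BR-matching without a chromatic cut such that all points of `F` on the boundary of the convex
hull of `F` have the same color. -/
def IsCircularMatching {n : ℕ} (F : BichromaticSet n) (M : Set BWSegment) : Prop :=
  IsBRMatching F M ∧ ¬ HasChromaticCut M ∧
    (F.points ∩ frontier (convexHull ℝ F.points) ⊆ F.white ∨
      F.points ∩ frontier (convexHull ℝ F.points) ⊆ F.black)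

/-- Any two different members of `S` are comparable by the sidedness relation. -/
def SidedTotalOn (S : Set BWSegment) : Prop :=
  ∀ A ∈ S, ∀ B ∈ S, A ≠ B → A.Sided B ∨ B.Sided A

/-- The sidedness relation is a (strict) linear order on `S`. -/
def SidedLinearOn (S : Set BWSegment) : Prop :=
  IsStrictTotalOrder S fun A B => (A : BWSegment).Sided B

/-- The members of `M` to the right of `B`. -/
def rightPart (M : Set BWSegment) (B : BWSegment) : Set BWSegment := {X ∈ M | B.Sided X}

/-- The members of `M` to the left of `B`. -/
def leftPart (M : Set BWSegment) (B : BWSegment) : Set BWSegment := {X ∈ M | X.Sided B}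

/-- `A` is the minimum of `S` with respect to the sidedness relation. -/
def IsSidedMin (S : Set BWSegment) (A : BWSegment) : Prop := A ∈ S ∧ ∀ X ∈ S, X ≠ A → A.Sided X

/-- `A` is the maximum of `S` with respect to the sidedness relation. -/
def IsSidedMax (S : Set BWSegment) (A : BWSegment) : Prop := A ∈ S ∧ ∀ X ∈ S, X ≠ A → X.Sided A

/-- `X` comes strictly before `Y` in the sequence that starts with the base segment `B`, continues
with the segments to the right of `B` sorted by the sidedness relation, and ends with the segments
to the left of `B` sorted by the sidedness relation. -/
def GluedBefore (B X Y : BWSegment) : Prop :=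
  (X = B ∧ Y ≠ B) ∨
  (B.Sided X ∧ B.Sided Y ∧ X.Sided Y) ∨
  (B.Sided X ∧ Y.Sided B) ∨
  (X.Sided B ∧ Y.Sided B ∧ X.Sided Y)

/-- The relation `[X, Y, Z]` obtained by closing this sequence up to a cycle. -/
def GluedBtw (B X Y Z : BWSegment) : Prop :=
  (GluedBefore B X Y ∧ GluedBefore B Y Z) ∨
  (GluedBefore B Y Z ∧ GluedBefore B Z X) ∨
  (GluedBefore B Z X ∧ GluedBefore B X Y)

/-!
The function `A.side x`, the orientation of the ends of `A` and `x`, describes the position of `x`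
with respect to the directed line of `A`. Two segments `A`, `B` are comparable by the sidedness
relation `◁` exactly if the ends of `B`, seen from `A`, and the ends of `A`, seen from `B`, always
lie on opposite sides (`sided_or_sided_iff`). If instead an end of each lies on the same side of the
other, then a line through nearby inner points is a chromatic cut (`exists_cut`); and disjoint
segments fail to be comparable only by forming a pattern (a) or (b), as the intersection point of
the two lines shows. So totality of `◁` means both the absence of chromatic cuts and the absence of
these patterns.

A total `◁` is not linear exactly if it has a cyclic triple `A ◁ B ◁ C ◁ A`. In such a triple the
sign of the cross product of the directions of `A` and `B` is an orientation of a triangle, hence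
the same for all three pairs (`IsCycle.turn_mul_orient_pos`). Therefore the three lines meet on rays
of one color, which makes the triple a `3`-star, and the ends of this color lie inside the triangle
of the other ends (`IsCycle.black_mem_interior`). Moreover no segment lies to the right, or to the
left, of all three (`IsCycle.not_sink`, `IsCycle.not_source`): `◁` is a locally transitive
tournament on the matching. In a locally transitive tournament with a cyclic triple every vertex
forms a cyclic triple with an edge of the given one; two cyclic triples with a common edge meet on
rays of the same color, so no end of that color is on the hull. If `◁` is linear, on the contrary,
then both ends of its minimum are on the hull.

The rest is combinatorics of tournaments. The circular order consists of the triples `X, Y, Z` for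
which at least two of `X ◁ Y`, `Y ◁ Z`, `Z ◁ X` hold, a description without a base segment. Two
compatible matchings arise by connecting the white end (for the other one, the black end) of every
segment with the other-colored end of its successor in the circular order; the lines of the given
segments separate all pairs of segments that might cross.
-/

/-! ### The orientation determinant -/

theorem orient_combo (p q x y : Plane) {a b : ℝ} (h : a + b = 1) :
    orient p q (a • x + b • y) = a * orient p q x + b * orient p q y := by
  obtain rfl : b = 1 - a := by linarith
  simp only [orient, PiLp.add_apply, PiLp.smul_apply, smul_eq_mul]
  ring

theorem orient_rotate (p q r : Plane) : orient q r p = orient p q r := by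
  simp only [orient]
  ring

theorem orient_swap (p q r : Plane) : orient q p r = -orient p q r := by
  simp only [orient]
  ring

theorem orient_left (p q : Plane) : orient p q p = 0 := by
  simp only [orient]
  ring

theorem orient_right (p q : Plane) : orient p q q = 0 := by
  simp only [orient]
  ring

theorem continuous_orient (p q : Plane) : Continuous (orient p q) := by
  unfold orient
  fun_prop

theorem sq_add_sq_pos_of_ne {p q : Plane} (h : p ≠ q) :
    0 < (q 0 - p 0) ^ 2 + (q 1 - p 1) ^ 2 := by
  by_contra! hle
  have h0 : q 0 - p 0 = 0 := by
    nlinarith [sq_nonneg (q 0 - p 0), sq_nonneg (q 1 - p 1)]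
  have h1 : q 1 - p 1 = 0 := by
    nlinarith [sq_nonneg (q 0 - p 0), sq_nonneg (q 1 - p 1)]
  apply h
  ext i
  fin_cases i
  · exact (sub_eq_zero.1 h0).symm
  · exact (sub_eq_zero.1 h1).symm

theorem exists_eq_add_smul_of_orient_eq_zero {p q r : Plane} (hpq : p ≠ q)
    (h : orient p q r = 0) : ∃ t : ℝ, r = p + t • (q - p) := by
  have hpos := sq_add_sq_pos_of_ne hpq
  refine ⟨((q 0 - p 0) * (r 0 - p 0) + (q 1 - p 1) * (r 1 - p 1)) /
    ((q 0 - p 0) ^ 2 + (q 1 - p 1) ^ 2), ?_⟩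
  unfold orient at h
  ext i
  fin_cases i
  · simp only [Fin.zero_eta, PiLp.add_apply, PiLp.smul_apply, PiLp.sub_apply, smul_eq_mul]
    field_simp
    linear_combination -(q 1 - p 1) * h
  · simp only [Fin.mk_one, PiLp.add_apply, PiLp.smul_apply, PiLp.sub_apply, smul_eq_mul]
    field_simp
    linear_combination (q 0 - p 0) * h

theorem collinear_of_orient_eq_zero {p q r : Plane} (hpq : p ≠ q) (h : orient p q r = 0) :
    Collinear ℝ {p, q, r} := by
  obtain ⟨t, rfl⟩ := exists_eq_add_smul_of_orient_eq_zero hpq h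
  rw [collinear_iff_of_mem (p₀ := p) (by simp)]
  refine ⟨q - p, ?_⟩
  simp only [Set.mem_insert_iff, Set.mem_singleton_iff, forall_eq_or_imp, forall_eq]
  exact ⟨⟨0, by simp⟩, ⟨1, by simp⟩, ⟨t, by simp [add_comm]⟩⟩

/-- If `m` and `k` lie on the line `pq`, then the functions `orient p q` and `orient m k` are
proportional. -/
theorem orient_mul_orient_of_orient_eq_zero {p q m k : Plane} (hm : orient p q m = 0)
    (hk : orient p q k = 0) (x y : Plane) :
    orient p q x * orient m k y = orient p q y * orient m k x := by
  have h : orient p q x * orient m k y - orient p q y * orient m k x =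
      (orient p q k - orient p q m) * orient m x y +
        orient p q m * (orient m k y - orient m k x) := by
    simp only [orient]
    ring
  rw [hm, hk] at h
  linarith

theorem orient_pos_of_mem_openSegment {p q x y z : Plane} (hx : 0 ≤ orient p q x)
    (hy : 0 ≤ orient p q y) (hxy : 0 < orient p q x ∨ 0 < orient p q y)
    (hz : z ∈ openSegment ℝ x y) : 0 < orient p q z := by
  obtain ⟨a, b, ha, hb, hab, rfl⟩ := hz
  rw [orient_combo _ _ _ _ hab]
  rcases hxy with h | h
  · have := mul_pos ha h
    have := mul_nonneg hb.le hy
    linarith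
  · have := mul_pos hb h
    have := mul_nonneg ha.le hx
    linarith

theorem orient_neg_of_mem_openSegment {p q x y z : Plane} (hx : orient p q x ≤ 0)
    (hy : orient p q y ≤ 0) (hxy : orient p q x < 0 ∨ orient p q y < 0)
    (hz : z ∈ openSegment ℝ x y) : orient p q z < 0 := by
  have := orient_pos_of_mem_openSegment (p := q) (q := p) (x := x) (y := y) (z := z)
  simp only [orient_swap p q, Left.nonneg_neg_iff, Left.neg_pos_iff] at this
  exact this hx hy hxy hz

theorem exists_mem_openSegment_orient_eq_zero {p q x y : Plane}
    (h : orient p q x * orient p q y < 0) :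
    ∃ a b : ℝ, 0 < a ∧ 0 < b ∧ a + b = 1 ∧ orient p q (a • x + b • y) = 0 := by
  have key : ∀ u v : ℝ, u * v < 0 → 0 < v / (v - u) := by
    intro u v huv
    rcases mul_neg_iff.1 huv with ⟨h1, h2⟩ | ⟨h1, h2⟩
    · exact div_pos_of_neg_of_neg h2 (by linarith)
    · exact div_pos h2 (by linarith)
  have hne : orient p q y - orient p q x ≠ 0 := by
    intro h0
    rw [sub_eq_zero.1 h0] at h
    nlinarith [mul_self_nonneg (orient p q x)]
  have hne' : orient p q x - orient p q y ≠ 0 := fun h0 => hne (by linarith)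
  have hab : orient p q y / (orient p q y - orient p q x) +
      orient p q x / (orient p q x - orient p q y) = 1 := by
    field_simp
    ring
  refine ⟨_, _, key _ _ h, key _ _ (by linarith), hab, ?_⟩
  rw [orient_combo _ _ _ _ hab]
  field_simp
  ring

/-- Near every point of a segment off a given line there are inner points of the segment on the same
side of the line. -/
theorem exists_mem_openSegment_orient_mul_pos {p q x y z : Plane} (hz : z ∈ segment ℝ x y)
    (h : orient p q z ≠ 0) : ∃ m ∈ openSegment ℝ x y, 0 < orient p q m * orient p q z := by
  have hopen : IsOpen {m : Plane | 0 < orient p q m * orient p q z} :=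
    isOpen_lt continuous_const ((continuous_orient p q).mul continuous_const)
  obtain ⟨m, hm, hm'⟩ := mem_closure_iff.1 (segment_subset_closure_openSegment hz) _ hopen
    (mul_self_pos.2 h)
  exact ⟨m, hm', hm⟩

theorem mem_interior_convexHull_of_orient_pos {p q r x : Plane} (h1 : 0 < orient p q x)
    (h2 : 0 < orient q r x) (h3 : 0 < orient r p x) :
    x ∈ interior (convexHull ℝ {p, q, r}) := by
  have hopen : IsOpen {x : Plane | 0 < orient p q x ∧ 0 < orient q r x ∧ 0 < orient r p x} :=
    (isOpen_lt continuous_const (continuous_orient p q)).inter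
      ((isOpen_lt continuous_const (continuous_orient q r)).inter
        (isOpen_lt continuous_const (continuous_orient r p)))
  refine interior_maximal ?_ hopen ⟨h1, h2, h3⟩
  rintro y ⟨h1, h2, h3⟩
  have hs : 0 < orient q r y + orient r p y + orient p q y := by linarith
  -- The barycentric coordinates of `y` are the normalized orientation determinants.
  have hy : y = ∑ i : Fin 3, (![orient q r y, orient r p y, orient p q y] i /
      (orient q r y + orient r p y + orient p q y)) • ![p, q, r] i := by
    simp only [Fin.sum_univ_three, Matrix.cons_val_zero, Matrix.cons_val_one, Matrix.cons_val]
    ext i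
    fin_cases i
    · simp only [Fin.zero_eta, PiLp.add_apply, PiLp.smul_apply, smul_eq_mul]
      field_simp
      simp only [orient]
      ring
    · simp only [Fin.mk_one, PiLp.add_apply, PiLp.smul_apply, smul_eq_mul]
      field_simp
      simp only [orient]
      ring
  rw [hy]
  refine (convex_convexHull ℝ _).sum_mem ?_ ?_ ?_
  · intro i _
    fin_cases i
    · exact (div_pos h2 hs).le
    · exact (div_pos h3 hs).le
    · exact (div_pos h1 hs).le
  · simp only [Fin.sum_univ_three, Matrix.cons_val_zero, Matrix.cons_val_one, Matrix.cons_val]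
    field_simp
  · intro i _
    apply subset_convexHull
    fin_cases i <;> simp

theorem mem_frontier_convexHull_of_orient_nonpos {s : Set Plane} {p q x : Plane} (hpq : p ≠ q)
    (hs : ∀ y ∈ s, orient p q y ≤ 0) (hx : x ∈ s) (h0 : orient p q x = 0) :
    x ∈ frontier (convexHull ℝ s) := by
  refine ⟨subset_closure (subset_convexHull ℝ s hx), fun hint => ?_⟩
  have hull : convexHull ℝ s ⊆ {y | orient p q y ≤ 0} := by
    refine convexHull_min hs ?_
    intro y hy z hz a b ha hb hab
    simp only [Set.mem_ofPred_eq] at hy hz ⊢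
    rw [orient_combo _ _ _ _ hab]
    nlinarith [mul_nonneg ha (neg_nonneg.2 hy), mul_nonneg hb (neg_nonneg.2 hz)]
  -- Moving `x` to the left of the line leaves the hull at once.
  have hcont : Continuous fun t : ℝ => x + t • (!₂[-(q 1 - p 1), q 0 - p 0] : Plane) := by
    fun_prop
  have hev := (hcont.tendsto' 0 x (by simp)).eventually (isOpen_interior.mem_nhds hint)
  obtain ⟨t, ht, htpos⟩ := ((hev.filter_mono nhdsWithin_le_nhds).and
    (self_mem_nhdsWithin : Set.Ioi (0 : ℝ) ∈ nhdsWithin 0 (Set.Ioi 0))).exists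
  have hle : orient p q (x + t • (!₂[-(q 1 - p 1), q 0 - p 0] : Plane)) ≤ 0 :=
    hull (interior_subset ht)
  have heq : orient p q (x + t • (!₂[-(q 1 - p 1), q 0 - p 0] : Plane)) =
      orient p q x + t * ((q 0 - p 0) ^ 2 + (q 1 - p 1) ^ 2) := by
    simp [orient]
    ring
  rw [heq, h0] at hle
  have := mul_pos (show 0 < t from htpos) (sq_add_sq_pos_of_ne hpq)
  linarith

namespace BWSegment

/-! ### Comparable pairs of segments -/

/-- The position of `x` with respect to the directed supporting line of `A`: positive on the left,
negative on the right, zero on the line. -/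
abbrev side (A : BWSegment) (x : Plane) : ℝ := orient A.white A.black x

/-- The cross product of the directions of `A` and `B`. -/
def turn (A B : BWSegment) : ℝ :=
  (A.black 0 - A.white 0) * (B.black 1 - B.white 1) -
    (A.black 1 - A.white 1) * (B.black 0 - B.white 0)

/-- The segment with exchanged colors. -/
def swap (A : BWSegment) : BWSegment := ⟨A.black, A.white⟩

theorem turn_comm (A B : BWSegment) : turn B A = -turn A B := by
  simp only [turn]
  ring

theorem turn_swap (A B : BWSegment) : turn A.swap B.swap = turn A B := by
  simp only [turn, swap]
  ring

theorem side_black (A B : BWSegment) : A.side B.black = A.side B.white + turn A B := by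
  simp only [side, orient, turn]
  ring

theorem sided_swap {A B : BWSegment} : A.swap.Sided B.swap ↔ B.Sided A := by
  simp only [Sided, LiesRightOf, LiesLeftOf, swap, orient_swap A.white A.black,
    orient_swap B.white B.black, Left.neg_neg_iff, Left.neg_pos_iff]
  tauto

theorem Sided.asymm {A B : BWSegment} (h : A.Sided B) : ¬ B.Sided A := fun h' =>
  lt_asymm h.1.1 h'.2.1

theorem Sided.irrefl (A : BWSegment) : ¬ A.Sided A := fun h => h.asymm h

/-- Comparability in terms of signs: every end of `B` with respect to the line of `A` is on the
opposite side to every end of `A` with respect to the line of `B`. -/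
theorem sided_or_sided_iff {A B : BWSegment} :
    (A.Sided B ∨ B.Sided A) ↔
      A.side B.white * B.side A.white < 0 ∧ A.side B.white * B.side A.black < 0 ∧
      A.side B.black * B.side A.white < 0 ∧ A.side B.black * B.side A.black < 0 := by
  simp only [Sided, LiesRightOf, LiesLeftOf, side, mul_neg_iff]
  constructor
  · rintro (⟨⟨h1, h2⟩, h3, h4⟩ | ⟨⟨h1, h2⟩, h3, h4⟩) <;> simp [*]
  · rintro ⟨h1 | h1, h2 | h2, h3 | h3, h4 | h4⟩ <;> first | (exfalso; linarith) | simp [*]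

/-- The position of the black end of `A` with respect to the line through an inner point of `A` and
a point `k` is governed by the position of `k` with respect to `A`. -/
theorem orient_combo_black (A : BWSegment) (k : Plane) {a b : ℝ} (h : a + b = 1) :
    orient (a • A.white + b • A.black) k A.black = -a * A.side k := by
  obtain rfl : b = 1 - a := by linarith
  simp only [orient, side, PiLp.add_apply, PiLp.smul_apply, smul_eq_mul]
  ring

theorem orient_combo_white (A : BWSegment) (k : Plane) {a b : ℝ} (h : a + b = 1) :
    orient (a • A.white + b • A.black) k A.white = b * A.side k := by
  obtain rfl : b = 1 - a := by linarith
  simp only [orient, side, PiLp.add_apply, PiLp.smul_apply, smul_eq_mul]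
  ring

/-- If a point `y` of `B` and a point `x` of `A` are on equal sides of the lines of `A` and `B`, then
a line through inner points near `x` and `y` is a chromatic cut. -/
theorem exists_cut {A B : BWSegment} {x y : Plane} (hx : x ∈ segment ℝ A.white A.black)
    (hy : y ∈ segment ℝ B.white B.black) (h : 0 < A.side y * B.side x) :
    ∃ p q : Plane, p ≠ q ∧ LineCrosses p q A ∧ LineCrosses p q B ∧
      orient p q A.black * orient p q B.black < 0 := by
  obtain ⟨hy0, hx0⟩ := mul_ne_zero_iff.1 h.ne'
  obtain ⟨m, ⟨a, b, ha, hb, hab, rfl⟩, hm⟩ := exists_mem_openSegment_orient_mul_pos hx hx0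
  obtain ⟨k, ⟨c, d, hc, hd, hcd, rfl⟩, hk⟩ := exists_mem_openSegment_orient_mul_pos hy hy0
  set m := a • A.white + b • A.black with hmdef
  set k := c • B.white + d • B.black with hkdef
  have hmk : 0 < A.side k * B.side m := by
    have := mul_pos hm hk
    by_contra! hle
    nlinarith [mul_nonneg (neg_nonneg.2 hle) h.le]
  obtain ⟨hk0, hm0⟩ := mul_ne_zero_iff.1 hmk.ne'
  have e1 : orient m k A.black = -a * A.side k := orient_combo_black A k hab
  have e2 : orient m k A.white = b * A.side k := orient_combo_white A k hab
  have e3 : orient m k B.black = c * B.side m := by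
    rw [orient_swap k m, hkdef, orient_combo_black B m hcd]
    ring
  have e4 : orient m k B.white = -d * B.side m := by
    rw [orient_swap k m, hkdef, orient_combo_white B m hcd]
    ring
  refine ⟨m, k, ?_, ?_, ?_, ?_⟩
  · intro hEq
    apply hk0
    rw [← hEq, hmdef, side, orient_combo _ _ _ _ hab, orient_left, orient_right]
    ring
  · rw [LineCrosses, e1, e2]
    nlinarith [mul_pos (mul_pos ha hb) (mul_self_pos.2 hk0)]
  · rw [LineCrosses, e3, e4]
    nlinarith [mul_pos (mul_pos hc hd) (mul_self_pos.2 hm0)]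
  · rw [e1, e3]
    nlinarith [mul_pos (mul_pos ha hc) hmk]

/-- Comparable segments have no chromatic cut. -/
theorem not_cut_of_comparable {A B : BWSegment} (h : A.Sided B ∨ B.Sided A) {p q : Plane}
    (hA : LineCrosses p q A) (hB : LineCrosses p q B) :
    ¬ orient p q A.black * orient p q B.black < 0 := by
  intro hneg
  obtain ⟨a, b, ha, hb, hab, hm⟩ := exists_mem_openSegment_orient_eq_zero hA
  obtain ⟨c, d, hc, hd, hcd, hk⟩ := exists_mem_openSegment_orient_eq_zero hB
  obtain ⟨h1, h2, h3, h4⟩ := sided_or_sided_iff.1 h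
  have hmk : A.side (c • B.white + d • B.black) * B.side (a • A.white + b • A.black) < 0 := by
    rw [side, side, orient_combo _ _ _ _ hab, orient_combo _ _ _ _ hcd]
    nlinarith [mul_pos (mul_pos hc ha) (neg_pos.2 h1), mul_pos (mul_pos hc hb) (neg_pos.2 h2),
      mul_pos (mul_pos hd ha) (neg_pos.2 h3), mul_pos (mul_pos hd hb) (neg_pos.2 h4)]
  have e1 := orient_combo_black A (c • B.white + d • B.black) hab
  have e2 := orient_combo_black B (a • A.white + b • A.black) hcd
  set m := a • A.white + b • A.black
  set k := c • B.white + d • B.black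
  -- The points `m` and `k` lie on the line `pq`, so `orient p q` and `orient m k` are proportional.
  have key : orient p q A.black * orient m k B.black = orient p q B.black * orient m k A.black :=
    orient_mul_orient_of_orient_eq_zero hm hk _ _
  rw [orient_swap k m, e2, e1] at key
  have h5 : orient p q B.black ≠ 0 := fun h0 => by simp [h0] at hneg
  have h6 : orient p q A.black * (c * B.side m) = - (orient p q B.black * (a * A.side k)) := by
    linarith
  have h7 : 0 < (orient p q A.black * orient p q B.black) * (A.side k * B.side m) :=
    mul_pos_of_neg_of_neg hneg hmk
  nlinarith [mul_pos hc h7, mul_nonneg ha.le (sq_nonneg (orient p q B.black * A.side k)),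
    congrArg (fun z => z * (orient p q B.black * A.side k)) h6]

/-! ### Patterns of rays -/

theorem white_ne_black_of_side_ne_zero {A : BWSegment} {x : Plane} (h : A.side x ≠ 0) :
    A.white ≠ A.black := by
  intro h0
  apply h
  rw [side, ← h0]
  simp only [orient]
  ring

theorem side_mul_side_pos_of_not_patternA {A B : BWSegment}
    (hdisj : Disjoint (openSegment ℝ A.white A.black) (openSegment ℝ B.white B.black))
    (hw : A.side B.white ≠ 0) (hb : A.side B.black ≠ 0) (h : ¬ A.PatternA B) :
    0 < A.side B.white * A.side B.black := by
  refine (mul_ne_zero hw hb).lt_or_gt.resolve_left fun hneg => h ?_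
  obtain ⟨a, b, ha, hb, hab, hz⟩ := exists_mem_openSegment_orient_eq_zero hneg
  have hzo : a • B.white + b • B.black ∈ openSegment ℝ B.white B.black :=
    ⟨a, b, ha, hb, hab, rfl⟩
  refine ⟨a • B.white + b • B.black, ?_, openSegment_subset_segment _ _ _ hzo⟩
  obtain ⟨t, ht⟩ :=
    exists_eq_add_smul_of_orient_eq_zero (white_ne_black_of_side_ne_zero hw) hz
  rw [ht] at hzo ⊢
  rcases le_or_gt t 0 with h0 | h0
  · exact Or.inl ⟨-t, by linarith, by module⟩
  rcases le_or_gt 1 t with h1 | h1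
  · exact Or.inr ⟨t - 1, by linarith, by module⟩
  · exact absurd hzo (Set.disjoint_left.1 hdisj ⟨1 - t, t, by linarith, h0, by ring, by module⟩)

theorem whiteRay_inter_blackRay_nonempty {A B : BWSegment} (h1 : turn A B * B.side A.white < 0)
    (h2 : turn A B * A.side B.black < 0) : (A.whiteRay ∩ B.blackRay).Nonempty := by
  have h0 : turn A B ≠ 0 := fun h => by simp [h] at h1
  have hsq := mul_self_pos.2 h0
  -- The parameters of the common point of the two supporting lines, by Cramer's rule.
  refine ⟨A.white + (-B.side A.white / turn A B) • (A.white - A.black),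
    ⟨_, ?_, rfl⟩, ⟨-A.side B.black / turn A B, ?_, ?_⟩⟩
  · rw [← mul_div_mul_left _ _ h0]
    exact div_nonneg (by linarith) hsq.le
  · rw [← mul_div_mul_left _ _ h0]
    exact div_nonneg (by linarith) hsq.le
  · ext i
    fin_cases i
    · simp only [Fin.zero_eta, PiLp.add_apply, PiLp.smul_apply, PiLp.sub_apply, smul_eq_mul]
      field_simp
      simp only [side, orient, turn]
      ring
    · simp only [Fin.mk_one, PiLp.add_apply, PiLp.smul_apply, PiLp.sub_apply, smul_eq_mul]
      field_simp
      simp only [side, orient, turn]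
      ring

theorem side_swap (A : BWSegment) (x : Plane) : A.swap.side x = -A.side x :=
  orient_swap A.white A.black x

theorem turn_swap_left (A B : BWSegment) : turn A.swap B = -turn A B := by
  simp only [turn, swap]
  ring

theorem blackRay_inter_blackRay_nonempty {A B : BWSegment} (h1 : 0 < turn A B * B.side A.black)
    (h2 : turn A B * A.side B.black < 0) : (A.blackRay ∩ B.blackRay).Nonempty := by
  refine whiteRay_inter_blackRay_nonempty (A := A.swap) ?_ ?_
  · rw [turn_swap_left]
    simp only [swap]
    linarith
  · rw [turn_swap_left, side_swap]
    linarith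

theorem Sided.blackRay_inter {A B : BWSegment} (h : A.Sided B) (ht : 0 < turn A B) :
    (A.blackRay ∩ B.blackRay).Nonempty :=
  blackRay_inter_blackRay_nonempty (mul_pos ht h.2.2) (mul_neg_of_pos_of_neg ht h.1.2)

theorem Sided.whiteRay_inter {A B : BWSegment} (h : A.Sided B) (ht : turn A B < 0) :
    (A.whiteRay ∩ B.whiteRay).Nonempty := by
  rw [Set.inter_comm]
  refine Sided.blackRay_inter (sided_swap.2 h) ?_
  rw [turn_swap, turn_comm]
  linarith

/-- Two disjoint segments, neither of which has an end on the line of the other, are comparable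
unless they form one of the patterns (a) and (b). -/
theorem comparable_of_not_pattern {A B : BWSegment}
    (hdisj : Disjoint (openSegment ℝ A.white A.black) (openSegment ℝ B.white B.black))
    (hw : A.side B.white ≠ 0) (hb : A.side B.black ≠ 0)
    (hw' : B.side A.white ≠ 0) (hb' : B.side A.black ≠ 0)
    (ha₁ : ¬ A.PatternA B) (ha₂ : ¬ B.PatternA A) (hb₁ : ¬ A.PatternB B) (hb₂ : ¬ B.PatternB A) :
    A.Sided B ∨ B.Sided A := by
  have hA := side_mul_side_pos_of_not_patternA hdisj hw hb ha₁
  have hB := side_mul_side_pos_of_not_patternA hdisj.symm hw' hb' ha₂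
  have eA := side_black A B
  have eB := side_black B A
  rw [turn_comm] at eB
  have h₁ : ¬ (turn A B * B.side A.white < 0 ∧ turn A B * A.side B.black < 0) := fun h =>
    hb₁ (Or.inl (whiteRay_inter_blackRay_nonempty h.1 h.2))
  have h₂ : ¬ (0 < turn A B * A.side B.white ∧ 0 < turn A B * B.side A.black) := fun h =>
    hb₂ (Or.inl (whiteRay_inter_blackRay_nonempty (by rw [turn_comm]; linarith)
      (by rw [turn_comm]; linarith)))
  -- Parallel segments on equal sides of each other are antiparallel.
  have h₃ : turn A B = 0 → ¬ 0 < A.side B.white * B.side A.white := by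
    intro h0 hpos
    apply hb₁
    right
    have hne := sq_add_sq_pos_of_ne (white_ne_black_of_side_ne_zero hw)
    set N := (A.black 0 - A.white 0) ^ 2 + (A.black 1 - A.white 1) ^ 2 with hN
    set k := ((A.black 0 - A.white 0) * (B.black 0 - B.white 0) +
        (A.black 1 - A.white 1) * (B.black 1 - B.white 1)) with hk
    have hkN : B.black - B.white = (k / N) • (A.black - A.white) := by
      simp only [turn] at h0
      ext i
      fin_cases i
      · simp only [Fin.zero_eta, PiLp.smul_apply, PiLp.sub_apply, smul_eq_mul]
        field_simp
        rw [hN, hk]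
        linear_combination -(A.black 1 - A.white 1) * h0
      · simp only [Fin.mk_one, PiLp.smul_apply, PiLp.sub_apply, smul_eq_mul]
        field_simp
        rw [hN, hk]
        linear_combination (A.black 0 - A.white 0) * h0
    refine ⟨k / N, ?_, hkN⟩
    have hx : B.black 0 - B.white 0 = k / N * (A.black 0 - A.white 0) := by
      simpa using congrFun (congrArg WithLp.ofLp hkN) 0
    have hy : B.black 1 - B.white 1 = k / N * (A.black 1 - A.white 1) := by
      simpa using congrFun (congrArg WithLp.ofLp hkN) 1
    have hs : B.side A.white = -(k / N) * A.side B.white := by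
      simp only [side, orient]
      rw [hx, hy]
      ring
    rw [hs] at hpos
    by_contra! hle
    nlinarith [mul_nonneg hle (sq_nonneg (A.side B.white))]
  rcases lt_trichotomy (turn A B) 0 with ht | ht | ht
  · rcases pos_and_pos_or_neg_and_neg_of_mul_pos hA with ⟨p1, p2⟩ | ⟨p1, p2⟩ <;>
      rcases pos_and_pos_or_neg_and_neg_of_mul_pos hB with ⟨q1, q2⟩ | ⟨q1, q2⟩
    · exact absurd ⟨mul_neg_of_neg_of_pos ht q1, mul_neg_of_neg_of_pos ht p2⟩ h₁
    · exact Or.inr ⟨⟨q1, q2⟩, p1, p2⟩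
    · exact Or.inl ⟨⟨p1, p2⟩, q1, q2⟩
    · exact absurd ⟨mul_pos_of_neg_of_neg ht p1, mul_pos_of_neg_of_neg ht q2⟩ h₂
  · rcases pos_and_pos_or_neg_and_neg_of_mul_pos hA with ⟨p1, p2⟩ | ⟨p1, p2⟩ <;>
      rcases pos_and_pos_or_neg_and_neg_of_mul_pos hB with ⟨q1, q2⟩ | ⟨q1, q2⟩
    · exact absurd (mul_pos p1 q1) (h₃ ht)
    · exact Or.inr ⟨⟨q1, q2⟩, p1, p2⟩
    · exact Or.inl ⟨⟨p1, p2⟩, q1, q2⟩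
    · exact absurd (mul_pos_of_neg_of_neg p1 q1) (h₃ ht)
  · rcases pos_and_pos_or_neg_and_neg_of_mul_pos hA with ⟨p1, p2⟩ | ⟨p1, p2⟩ <;>
      rcases pos_and_pos_or_neg_and_neg_of_mul_pos hB with ⟨q1, q2⟩ | ⟨q1, q2⟩
    · exact absurd ⟨mul_pos ht p1, mul_pos ht q2⟩ h₂
    · exact Or.inr ⟨⟨q1, q2⟩, p1, p2⟩
    · exact Or.inl ⟨⟨p1, p2⟩, q1, q2⟩
    · exact absurd ⟨mul_neg_of_pos_of_neg ht q1, mul_neg_of_pos_of_neg ht p2⟩ h₁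

theorem not_patternA_of_comparable {A B : BWSegment} (h : A.Sided B ∨ B.Sided A) :
    ¬ A.PatternA B := by
  rintro ⟨z, hz, hzB⟩
  have hz0 : A.side z = 0 := by
    rcases hz with ⟨t, -, rfl⟩ | ⟨t, -, rfl⟩ <;>
    · simp only [side, orient, PiLp.add_apply, PiLp.smul_apply, PiLp.sub_apply, smul_eq_mul]
      ring
  obtain ⟨a, b, ha, hb, hab, rfl⟩ := hzB
  rw [side, orient_combo _ _ _ _ hab] at hz0
  obtain ⟨h1, h2⟩ | ⟨h1, h2⟩ : (A.side B.white < 0 ∧ A.side B.black < 0) ∨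
      (0 < A.side B.white ∧ 0 < A.side B.black) := h.imp (fun h => h.1) (fun h => h.2)
  · rcases ha.eq_or_lt with rfl | ha
    · simp only [zero_add] at hab
      subst hab
      linarith
    · nlinarith [mul_pos ha (neg_pos.2 h1), mul_nonneg hb (neg_pos.2 h2).le]
  · rcases ha.eq_or_lt with rfl | ha
    · simp only [zero_add] at hab
      subst hab
      linarith
    · nlinarith [mul_pos ha h1, mul_nonneg hb h2.le]

theorem not_patternB_of_comparable {A B : BWSegment} (h : A.Sided B ∨ B.Sided A) :
    ¬ A.PatternB B := by
  rintro (⟨z, ⟨t, ht, hzA⟩, ⟨s, hs, hzB⟩⟩ | ⟨k, hk, hkv⟩)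
  · have e1 : B.side A.white + t * turn A B = 0 := by
      have : B.side z = 0 := by
        rw [hzB]
        simp only [side, orient, PiLp.add_apply, PiLp.smul_apply, PiLp.sub_apply, smul_eq_mul]
        ring
      rw [← this, hzA]
      simp only [side, orient, turn, PiLp.add_apply, PiLp.smul_apply, PiLp.sub_apply, smul_eq_mul]
      ring
    have e2 : A.side B.black + s * turn A B = 0 := by
      have : A.side z = 0 := by
        rw [hzA]
        simp only [side, orient, PiLp.add_apply, PiLp.smul_apply, PiLp.sub_apply, smul_eq_mul]
        ring
      rw [← this, hzB]
      simp only [side, orient, turn, PiLp.add_apply, PiLp.smul_apply, PiLp.sub_apply, smul_eq_mul]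
      ring
    have h3 := (sided_or_sided_iff.1 h).2.2.1
    have h4 : A.side B.black * B.side A.white = s * t * turn A B ^ 2 := by
      rw [eq_neg_of_add_eq_zero_left e1, eq_neg_of_add_eq_zero_left e2]
      ring
    have := mul_nonneg (mul_nonneg hs ht) (sq_nonneg (turn A B))
    linarith
  · have hx : B.black 0 - B.white 0 = k * (A.black 0 - A.white 0) := by
      simpa using congrFun (congrArg WithLp.ofLp hkv) 0
    have hy : B.black 1 - B.white 1 = k * (A.black 1 - A.white 1) := by
      simpa using congrFun (congrArg WithLp.ofLp hkv) 1
    have hs : B.side A.white = -k * A.side B.white := by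
      simp only [side, orient]
      rw [hx, hy]
      ring
    have h1 := (sided_or_sided_iff.1 h).1
    rw [hs] at h1
    nlinarith [mul_nonneg (neg_nonneg.2 hk.le) (sq_nonneg (A.side B.white))]

/-! ### Cyclic triples -/

/-- A cyclic triple of the sidedness relation. -/
def IsCycle (A B C : BWSegment) : Prop := A.Sided B ∧ B.Sided C ∧ C.Sided A

theorem IsCycle.rotate {A B C : BWSegment} (h : IsCycle A B C) : IsCycle B C A :=
  ⟨h.2.1, h.2.2, h.1⟩

theorem IsCycle.swap {A B C : BWSegment} (h : IsCycle A B C) :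
    IsCycle A.swap C.swap B.swap :=
  ⟨sided_swap.2 h.2.2, sided_swap.2 h.2.1, sided_swap.2 h.1⟩

/-- In a cyclic triple the lines of `A` and `B` are not parallel, and the sign of their cross
product is the orientation of the triangle formed by `B.white`, `y` and `x`, for every end `y` of
`C` and every end `x` of `A`. -/
theorem IsCycle.turn_mul_orient_pos {A B C : BWSegment} (h : IsCycle A B C) {x y : Plane}
    (hx : x = A.white ∨ x = A.black) (hy : y = C.white ∨ y = C.black) :
    0 < turn A B * orient B.white y x := by
  obtain ⟨⟨⟨h1, -⟩, h2, h3⟩, ⟨⟨h4, h5⟩, -⟩, ⟨-, h6, h7⟩⟩ := h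
  have hx0 : A.side x = 0 := by
    rcases hx with rfl | rfl
    exacts [orient_left _ _, orient_right _ _]
  have hBx : 0 < B.side x := by rcases hx with rfl | rfl <;> assumption
  have hBy : B.side y < 0 := by rcases hy with rfl | rfl <;> assumption
  have hAy : 0 < A.side y := by rcases hy with rfl | rfl <;> assumption
  have hA : A.side B.white < 0 := h1
  have key : turn A B * orient B.white y x =
      B.side x * (A.side y - A.side B.white) - B.side y * (A.side x - A.side B.white) := by
    simp only [side, orient, turn]
    ring
  rw [key, hx0]
  nlinarith [mul_pos hBx (sub_pos.2 (hA.trans hAy)), mul_pos_of_neg_of_neg hBy hA]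

theorem IsCycle.turn_ne_zero {A B C : BWSegment} (h : IsCycle A B C) : turn A B ≠ 0 := fun h0 => by
  have := h.turn_mul_orient_pos (Or.inl rfl) (Or.inl rfl)
  simp [h0] at this

theorem IsCycle.turn_pos_rotate {A B C : BWSegment} (h : IsCycle A B C) (h0 : 0 < turn A B) :
    0 < turn B C := by
  have h1 := h.turn_mul_orient_pos (Or.inl rfl) (Or.inl rfl)
  have h2 := h.rotate.turn_mul_orient_pos (Or.inl rfl) (Or.inl rfl)
  rw [orient_rotate] at h2
  exact pos_of_mul_pos_left h2 ((pos_iff_pos_of_mul_pos h1).1 h0).le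

theorem IsCycle.turn_neg_rotate {A B C : BWSegment} (h : IsCycle A B C) (h0 : turn A B < 0) :
    turn B C < 0 := by
  refine h.rotate.turn_ne_zero.lt_or_gt.resolve_right fun h1 => ?_
  exact lt_asymm h0 (h.rotate.rotate.turn_pos_rotate (h.rotate.turn_pos_rotate h1))

theorem IsCycle.threeStar {A B C : BWSegment} (h : IsCycle A B C) : ThreeStar A B C := by
  refine ⟨?_, Or.inr ⟨h.1.1, h.2.2.2⟩, Or.inr ⟨h.2.1.1, h.1.2⟩, Or.inr ⟨h.2.2.1, h.2.1.2⟩⟩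
  rcases h.turn_ne_zero.lt_or_gt with h0 | h0
  · have h1 := h.turn_neg_rotate h0
    exact Or.inl ⟨h.1.whiteRay_inter h0, h.2.1.whiteRay_inter h1,
      h.2.2.whiteRay_inter (h.rotate.turn_neg_rotate h1)⟩
  · have h1 := h.turn_pos_rotate h0
    exact Or.inr ⟨h.1.blackRay_inter h0, h.2.1.blackRay_inter h1,
      h.2.2.blackRay_inter (h.rotate.turn_pos_rotate h1)⟩

/-- If the black rays of a cyclic triple meet, the black ends are inside the triangle of the white
ends. -/
theorem IsCycle.black_mem_interior {A B C : BWSegment} (h : IsCycle A B C) (h0 : 0 < turn A B) :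
    A.black ∈ interior (convexHull ℝ {A.white, B.white, C.white}) := by
  refine mem_interior_convexHull_of_orient_pos ?_ ?_ ?_
  · rw [← orient_rotate, ← orient_rotate, orient_swap]
    exact neg_pos.2 h.1.1.1
  · exact pos_of_mul_pos_right (h.turn_mul_orient_pos (Or.inr rfl) (Or.inl rfl)) h0.le
  · rw [← orient_rotate]
    exact h.2.2.2.1

theorem IsCycle.white_mem_interior {A B C : BWSegment} (h : IsCycle A B C) (h0 : turn A B < 0) :
    A.white ∈ interior (convexHull ℝ {A.black, B.black, C.black}) := by
  have h1 := h.rotate.turn_neg_rotate (h.turn_neg_rotate h0)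
  have := h.swap.black_mem_interior (by rw [turn_swap, turn_comm]; linarith)
  rwa [Set.pair_comm] at this

/-- If `A` and `X` do not meet on the rays of the color on which `A` and `B` meet, then neither do
`B` and `X`, since the line of `X` then passes from the left to the right of `B` on its way from the
line of `A` to the segment `X`. -/
theorem turn_mul_turn_neg {A B X : BWSegment} (hAB : A.Sided B) (hAX : A.Sided X)
    (hBX : B.Sided X) (h0 : turn A B ≠ 0) (h : turn A B * turn A X ≤ 0) :
    turn A B * turn B X < 0 := by
  have h1 : 0 < B.side A.white := hAB.2.1
  have h2 : 0 < X.side A.white := hAX.2.1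
  have h3 : B.side X.white < 0 := hBX.1.1
  have h4 : A.side X.white < 0 := hAX.1.1
  have key : A.side X.white * (turn A B * turn B X) =
      X.side A.white * (turn A B * turn A B) +
        -(turn A B * turn A X) * (B.side A.white - B.side X.white) := by
    simp only [side, orient, turn]
    ring
  have h5 : 0 < A.side X.white * (turn A B * turn B X) := by
    rw [key]
    exact add_pos_of_pos_of_nonneg (mul_pos h2 (mul_self_pos.2 h0))
      (mul_nonneg (neg_nonneg.2 h) (by linarith))
  exact neg_of_mul_pos_right h5 h4.le

/-- No segment `X` lies to the right of all segments of a cyclic triple: the directions of the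
triple positively span the plane, so `X` does not meet all of them on rays of the color on which
they meet each other; but if it fails to do so for one of them, it fails for all. -/
theorem IsCycle.not_sink {A B C X : BWSegment} (h : IsCycle A B C) (hA : A.Sided X)
    (hB : B.Sided X) (hC : C.Sided X) : False := by
  have key : turn B C * turn A X + turn C A * turn B X + turn A B * turn C X = 0 := by
    simp only [turn]
    ring
  have hAB := turn_mul_turn_neg h.1 hA hB h.turn_ne_zero
  have hBC := turn_mul_turn_neg h.2.1 hB hC h.rotate.turn_ne_zero
  have hCA := turn_mul_turn_neg h.2.2 hC hA h.rotate.rotate.turn_ne_zero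
  rcases h.turn_ne_zero.lt_or_gt with h0 | h0
  · have h1 := h.turn_neg_rotate h0
    have h2 := h.rotate.turn_neg_rotate h1
    simp only [mul_neg_iff, mul_nonpos_iff, h0, h1, h2, h0.le, h1.le, h2.le, h0.not_gt, h1.not_gt,
      h2.not_gt, h0.not_ge, h1.not_ge, h2.not_ge, true_and, false_and, false_or] at hAB hBC hCA
    by_cases hX : 0 ≤ turn A X
    · have hX1 := hAB hX
      have hX2 := hBC hX1.le
      nlinarith [mul_nonpos_of_nonpos_of_nonneg h1.le hX, mul_neg_of_neg_of_pos h2 hX1,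
        mul_neg_of_neg_of_pos h0 hX2]
    · have hX1 : turn B X < 0 := by
        by_contra! hle
        exact hX (hCA (hBC hle).le).le
      have hX2 : turn C X < 0 := by
        by_contra! hle
        exact hX (hCA hle).le
      nlinarith [mul_pos_of_neg_of_neg h1 (not_le.1 hX), mul_pos_of_neg_of_neg h2 hX1,
        mul_pos_of_neg_of_neg h0 hX2]
  · have h1 := h.turn_pos_rotate h0
    have h2 := h.rotate.turn_pos_rotate h1
    simp only [mul_neg_iff, mul_nonpos_iff, h0, h1, h2, h0.le, h1.le, h2.le, h0.not_gt, h1.not_gt,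
      h2.not_gt, h0.not_ge, h1.not_ge, h2.not_ge, true_and, false_and, or_false] at hAB hBC hCA
    by_cases hX : turn A X ≤ 0
    · have hX1 := hAB hX
      have hX2 := hBC hX1.le
      nlinarith [mul_nonpos_of_nonneg_of_nonpos h1.le hX, mul_neg_of_pos_of_neg h2 hX1,
        mul_neg_of_pos_of_neg h0 hX2]
    · have hX1 : 0 < turn B X := by
        by_contra! hle
        exact hX (hCA (hBC hle).le).le
      have hX2 : 0 < turn C X := by
        by_contra! hle
        exact hX (hCA hle).le
      nlinarith [mul_pos h1 (not_le.1 hX), mul_pos h2 hX1, mul_pos h0 hX2]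

/-- No segment lies to the left of all segments of a cyclic triple. -/
theorem IsCycle.not_source {A B C X : BWSegment} (h : IsCycle A B C) (hA : X.Sided A)
    (hB : X.Sided B) (hC : X.Sided C) : False :=
  h.swap.not_sink (sided_swap.2 hA) (sided_swap.2 hC) (sided_swap.2 hB)

end BWSegment

/-! ### Locally transitive tournaments -/

/-- A tournament in which no vertex dominates, or is dominated by, a cyclic triple; equivalently, the
in-neighbors and the out-neighbors of every vertex are linearly ordered. -/
structure IsLocallyTransitiveTournament {α : Type*} (r : α → α → Prop) : Prop where
  asymm : ∀ {a b}, r a b → ¬ r b a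
  total : ∀ {a b}, a ≠ b → r a b ∨ r b a
  not_sink : ∀ {a b c x}, r a b → r b c → r c a → r a x → r b x → r c x → False
  not_source : ∀ {a b c x}, r a b → r b c → r c a → r x a → r x b → r x c → False

/-- At least two of `r a b`, `r b c`, `r c a` hold. If the vertices are points of a circle and
`r a b` means that the way from `a` to `b` in the positive direction is less than half of the circle,
then this says that `a`, `b`, `c` are in positive cyclic order. -/
def CyclicallyOrdered {α : Type*} (r : α → α → Prop) (a b c : α) : Prop :=
  (r a b ∧ r b c) ∨ (r b c ∧ r c a) ∨ (r c a ∧ r a b)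

/-- `b` is the immediate successor of `a`: the minimum of the out-neighbors of `a`. -/
def IsSuccessor {α : Type*} (r : α → α → Prop) (a b : α) : Prop :=
  r a b ∧ ∀ x, r a x → x ≠ b → r b x

namespace IsLocallyTransitiveTournament

variable {α : Type*} {r : α → α → Prop}

theorem irrefl (h : IsLocallyTransitiveTournament r) (a : α) : ¬ r a a := fun ha => h.asymm ha ha

theorem ne (h : IsLocallyTransitiveTournament r) {a b : α} (hab : r a b) : a ≠ b := by
  rintro rfl
  exact h.irrefl a hab

theorem trans_out (h : IsLocallyTransitiveTournament r) {x a b c : α} (ha : r x a) (hb : r x b)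
    (hc : r x c) (hab : r a b) (hbc : r b c) : r a c := by
  have hac : a ≠ c := by
    rintro rfl
    exact h.asymm hab hbc
  exact (h.total hac).resolve_right fun hca => h.not_source hab hbc hca ha hb hc

theorem trans_in (h : IsLocallyTransitiveTournament r) {x a b c : α} (ha : r a x) (hb : r b x)
    (hc : r c x) (hab : r a b) (hbc : r b c) : r a c := by
  have hac : a ≠ c := by
    rintro rfl
    exact h.asymm hab hbc
  exact (h.total hac).resolve_right fun hca => h.not_sink hab hbc hca ha hb hc

theorem cyclicallyOrdered_asymm (h : IsLocallyTransitiveTournament r) {a b c : α}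
    (h₁ : CyclicallyOrdered r a b c) : ¬ CyclicallyOrdered r c b a := by
  have h1 := @h.asymm a b
  have h2 := @h.asymm b c
  have h3 := @h.asymm c a
  unfold CyclicallyOrdered at *
  tauto

theorem cyclicallyOrdered_total (h : IsLocallyTransitiveTournament r) {a b c : α} (hab : a ≠ b)
    (hbc : b ≠ c) (hca : c ≠ a) : CyclicallyOrdered r a b c ∨ CyclicallyOrdered r c b a := by
  have h1 := h.total hab
  have h2 := h.total hbc
  have h3 := h.total hca
  unfold CyclicallyOrdered
  tauto

theorem cyclicallyOrdered_ne (h : IsLocallyTransitiveTournament r) {a b c : α}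
    (h₁ : CyclicallyOrdered r a b c) : a ≠ b ∧ b ≠ c ∧ c ≠ a := by
  have := @h.asymm
  refine ⟨?_, ?_, ?_⟩ <;> rintro rfl <;> unfold CyclicallyOrdered at h₁ <;> grind

theorem cyclicallyOrdered_trans (h : IsLocallyTransitiveTournament r) {a b c d : α}
    (h₁ : CyclicallyOrdered r a b c) (h₂ : CyclicallyOrdered r b d c) :
    CyclicallyOrdered r a d c := by
  have had : a ≠ d := by
    rintro rfl
    exact h.cyclicallyOrdered_asymm h₁ (by unfold CyclicallyOrdered at *; tauto)
  have a1 := @h.asymm a b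
  have a2 := @h.asymm b c
  have a3 := @h.asymm c a
  have a4 := @h.asymm b d
  have a5 := @h.asymm d c
  have a6 := @h.asymm a d
  have t1 := h.total had
  have t2 := h.total (h.cyclicallyOrdered_ne h₁).1
  have t3 := h.total (h.cyclicallyOrdered_ne h₁).2.1
  have t4 := h.total (h.cyclicallyOrdered_ne h₁).2.2
  have t5 := h.total (h.cyclicallyOrdered_ne h₂).1
  have t6 := h.total (h.cyclicallyOrdered_ne h₂).2.1
  have s1 := @h.not_sink
  have s2 := @h.not_source
  unfold CyclicallyOrdered at *
  grind

/-- The circular order of a locally transitive tournament. -/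
@[reducible] def circularOrder (h : IsLocallyTransitiveTournament r) : CircularOrder α where
  btw a b c := ¬ CyclicallyOrdered r c b a
  sbtw a b c := CyclicallyOrdered r a b c
  btw_refl a h₁ := (h.cyclicallyOrdered_ne h₁).1 rfl
  btw_cyclic_left h₁ h₂ := h₁ (by unfold CyclicallyOrdered at *; tauto)
  sbtw_iff_btw_not_btw := by
    intro a b c
    exact ⟨fun h₁ => ⟨h.cyclicallyOrdered_asymm h₁, not_not.2 h₁⟩, fun h₁ => not_not.1 h₁.2⟩
  sbtw_trans_left := h.cyclicallyOrdered_trans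
  btw_antisymm := by
    intro a b c h₁ h₂
    by_contra! hne
    exact (h.cyclicallyOrdered_total hne.1 hne.2.1 hne.2.2).elim h₂ h₁
  btw_total a b c := by
    by_contra! h₁
    exact h.cyclicallyOrdered_asymm h₁.2 h₁.1

/-- A cyclic triple is dominated by no vertex and dominates none, so every vertex `x` forms a
cyclic triple with two consecutive vertices of it. -/
theorem exists_cycle (h : IsLocallyTransitiveTournament r) {a b c : α} (hab : r a b) (hbc : r b c)
    (hca : r c a) (x : α) : ∃ p q, r x p ∧ r p q ∧ r q x ∧
      ((p = a ∧ q = b) ∨ (p = b ∧ q = c) ∨ (p = c ∧ q = a)) := by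
  by_cases hxa : x = a
  · subst hxa
    exact ⟨b, c, hab, hbc, hca, by simp⟩
  by_cases hxb : x = b
  · subst hxb
    exact ⟨c, a, hbc, hca, hab, by simp⟩
  by_cases hxc : x = c
  · subst hxc
    exact ⟨a, b, hca, hab, hbc, by simp⟩
  have h1 := @h.not_sink a b c x
  have h2 := @h.not_source a b c x
  rcases h.total hxa with h3 | h3 <;> rcases h.total hxb with h4 | h4 <;>
    rcases h.total hxc with h5 | h5
  · exact (h2 hab hbc hca h3 h4 h5).elim
  · exact ⟨b, c, h4, hbc, h5, by simp⟩
  · exact ⟨a, b, h3, hab, h4, by simp⟩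
  · exact ⟨a, b, h3, hab, h4, by simp⟩
  · exact ⟨c, a, h5, hca, h3, by simp⟩
  · exact ⟨b, c, h4, hbc, h5, by simp⟩
  · exact ⟨c, a, h5, hca, h3, by simp⟩
  · exact (h1 hab hbc hca h3 h4 h5).elim

/-- The last out-neighbor of `x` precedes the first in-neighbor of `x`. -/
theorem max_out_rel_min_in (h : IsLocallyTransitiveTournament r) {x p q z a : α} (hxp : r x p)
    (hpq : r p q) (hqx : r q x) (hxz : r x z) (hz : ∀ y, r x y → y ≠ z → r y z) (hax : r a x)
    (ha : ∀ y, r y x → y ≠ a → r a y) : r z a := by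
  have hza : z ≠ a := by
    rintro rfl
    exact h.asymm hxz hax
  refine (h.total hza).resolve_right fun haz => ?_
  have hap : r a p := by
    by_cases hpz : p = z
    · exact hpz ▸ haz
    have hpa : p ≠ a := by
      rintro rfl
      exact h.asymm hxp hax
    exact (h.total hpa).resolve_left fun hpa =>
      h.not_sink hax hxp hpa haz hxz (hz p hxp hpz)
  have hqa : q ≠ a := by
    rintro rfl
    exact h.asymm hpq hap
  exact h.not_source hxp hpq hqx hax hap (ha q hqx hqa)

theorem exists_isSuccessor (h : IsLocallyTransitiveTournament r) [Finite α] {a b : α}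
    (hab : r a b) : ∃ s, IsSuccessor r a s := by
  have : IsTrans {x // r a x} (fun x y => r x y) :=
    ⟨fun x y z hxy hyz => h.trans_out x.2 y.2 z.2 hxy hyz⟩
  have : Std.Irrefl (fun x y : {x // r a x} => r x y) := ⟨fun x => h.irrefl x⟩
  have wf := Finite.wellFounded_of_trans_of_irrefl (fun x y : {x // r a x} => r x y)
  obtain ⟨s, -, hs⟩ := wf.has_min Set.univ ⟨⟨b, hab⟩, trivial⟩
  exact ⟨s, s.2, fun x hx hxs => (h.total hxs).resolve_left (hs ⟨x, hx⟩ trivial)⟩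

/-- The position of a third vertex with respect to `a` and its successor `b`. -/
theorem isSuccessor_trichotomy (h : IsLocallyTransitiveTournament r) {a b x : α}
    (hab : IsSuccessor r a b) (hxa : x ≠ a) (hxb : x ≠ b) :
    (r a x ∧ r b x) ∨ (r x a ∧ r x b) ∨ (r b x ∧ r x a) := by
  rcases h.total hxa with h1 | h1
  · rcases h.total hxb with h2 | h2
    · exact Or.inr (Or.inl ⟨h1, h2⟩)
    · exact Or.inr (Or.inr ⟨h2, h1⟩)
  · exact Or.inl ⟨h1, hab.2 x h1 hxb⟩

theorem isSuccessor_injective (h : IsLocallyTransitiveTournament r) {a b c : α}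
    (hac : IsSuccessor r a c) (hbc : IsSuccessor r b c) : a = b := by
  by_contra hab
  rcases h.total hab with h1 | h1
  · exact h.asymm hbc.1 (hac.2 b h1 (h.ne hbc.1))
  · exact h.asymm hac.1 (hbc.2 a h1 (h.ne hac.1))

/-- For two successor pairs, some vertex of one of them has the other vertex of its own pair on one
side and both vertices of the other pair, unless equal to it, on the other side. -/
theorem isSuccessor_separated (h : IsLocallyTransitiveTournament r) {a b c d : α}
    (hab : IsSuccessor r a b) (hcd : IsSuccessor r c d) (hac : a ≠ c) :
    (r b d ∧ (c = b ∨ r b c)) ∨ (r c a ∧ (d = a ∨ r d a)) ∨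
      (r d b ∧ (a = d ∨ r d a)) := by
  have hbd : b ≠ d := fun hbd => hac (h.isSuccessor_injective hab (hbd ▸ hcd))
  by_cases hbc : b = c
  · subst hbc
    exact Or.inl ⟨hcd.1, Or.inl rfl⟩
  by_cases had : a = d
  · subst had
    exact Or.inr (Or.inl ⟨hcd.1, Or.inl rfl⟩)
  rcases h.isSuccessor_trichotomy hab (Ne.symm hac) (Ne.symm hbc) with h1 | h1 | h1 <;>
    rcases h.isSuccessor_trichotomy hab (Ne.symm had) (Ne.symm hbd) with h2 | h2 | h2
  · exact Or.inl ⟨h2.2, Or.inr h1.2⟩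
  · exact Or.inr (Or.inr ⟨h2.2, Or.inr h2.1⟩)
  · exact Or.inl ⟨h2.1, Or.inr h1.2⟩
  · exact absurd h2.1 (h.asymm (hcd.2 a h1.1 had))
  · exact Or.inr (Or.inl ⟨h1.1, Or.inr h2.1⟩)
  · exact Or.inr (Or.inl ⟨h1.1, Or.inr h2.2⟩)
  · exact Or.inl ⟨h2.2, Or.inr h1.1⟩
  · exact Or.inr (Or.inl ⟨h1.2, Or.inr h2.1⟩)
  · exact Or.inl ⟨h2.1, Or.inr h1.1⟩

end IsLocallyTransitiveTournament

open BWSegment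

/-! ### Bichromatic matchings -/

namespace IsBRMatching

variable {n : ℕ} {F : BichromaticSet n} {M : Set BWSegment}

theorem eq_of_white_eq (hM : IsBRMatching F M) {A B : BWSegment} (hA : A ∈ M) (hB : B ∈ M)
    (h : A.white = B.white) : A = B :=
  (hM.white_unique _ (hM.white_mem A hA)).unique ⟨hA, rfl⟩ ⟨hB, h.symm⟩

theorem eq_of_black_eq (hM : IsBRMatching F M) {A B : BWSegment} (hA : A ∈ M) (hB : B ∈ M)
    (h : A.black = B.black) : A = B :=
  (hM.black_unique _ (hM.black_mem A hA)).unique ⟨hA, rfl⟩ ⟨hB, h.symm⟩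

theorem white_ne_black (hM : IsBRMatching F M) {A B : BWSegment} (hA : A ∈ M) (hB : B ∈ M) :
    A.white ≠ B.black := fun h =>
  Finset.disjoint_left.1 F.disjoint (hM.white_mem A hA) (h ▸ hM.black_mem B hB)

theorem finite (hM : IsBRMatching F M) : Finite M :=
  Finite.of_injective (fun A : M => (⟨A.1.white, hM.white_mem A A.2⟩ : F.white)) fun A B h =>
    Subtype.ext (hM.eq_of_white_eq A.2 B.2 (congrArg Subtype.val h))

theorem white_mem_points (hM : IsBRMatching F M) {A : BWSegment} (hA : A ∈ M) :
    A.white ∈ F.points := Or.inl (hM.white_mem A hA)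

theorem black_mem_points (hM : IsBRMatching F M) {A : BWSegment} (hA : A ∈ M) :
    A.black ∈ F.points := Or.inr (hM.black_mem A hA)

theorem exists_end (hM : IsBRMatching F M) {x : Plane} (hx : x ∈ F.points) :
    ∃ A ∈ M, x = A.white ∨ x = A.black := by
  rcases hx with hx | hx
  · obtain ⟨A, ⟨hA, h⟩, -⟩ := hM.white_unique x hx
    exact ⟨A, hA, Or.inl h.symm⟩
  · obtain ⟨A, ⟨hA, h⟩, -⟩ := hM.black_unique x hx
    exact ⟨A, hA, Or.inr h.symm⟩

theorem side_ne_zero (hM : IsBRMatching F M) {A B : BWSegment} (hA : A ∈ M) (hB : B ∈ M)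
    (hAB : A ≠ B) : A.side B.white ≠ 0 ∧ A.side B.black ≠ 0 := by
  have h := hM.white_ne_black hA hA
  refine ⟨fun h0 => ?_, fun h0 => ?_⟩
  · exact F.general_position _ _ _ (hM.white_mem_points hA) (hM.black_mem_points hA)
      (hM.white_mem_points hB) h (hM.white_ne_black hB hA).symm
      (fun h => hAB (hM.eq_of_white_eq hA hB h)) (collinear_of_orient_eq_zero h h0)
  · exact F.general_position _ _ _ (hM.white_mem_points hA) (hM.black_mem_points hA)
      (hM.black_mem_points hB) h (fun h => hAB (hM.eq_of_black_eq hA hB h))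
      (hM.white_ne_black hA hB) (collinear_of_orient_eq_zero h h0)

theorem sidedTotalOn_iff_not_hasChromaticCut (hM : IsBRMatching F M) :
    SidedTotalOn M ↔ ¬ HasChromaticCut M := by
  constructor
  · rintro h ⟨p, q, -, A, hA, B, hB, hcA, hcB, hneg⟩
    have hAB : A ≠ B := by
      rintro rfl
      exact (mul_self_nonneg _).not_gt hneg
    exact not_cut_of_comparable (h A hA B hB hAB) hcA hcB hneg
  · intro h A hA B hB hAB
    have key : ∀ x ∈ segment ℝ A.white A.black, ∀ y ∈ segment ℝ B.white B.black,
        A.side y * B.side x ≤ 0 := by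
      intro x hx y hy
      by_contra! hlt
      obtain ⟨p, q, hpq, h1, h2, h3⟩ := exists_cut hx hy hlt
      exact h ⟨p, q, hpq, A, hA, B, hB, h1, h2, h3⟩
    obtain ⟨h1, h2⟩ := hM.side_ne_zero hA hB hAB
    obtain ⟨h3, h4⟩ := hM.side_ne_zero hB hA hAB.symm
    have wA := left_mem_segment ℝ A.white A.black
    have bA := right_mem_segment ℝ A.white A.black
    have wB := left_mem_segment ℝ B.white B.black
    have bB := right_mem_segment ℝ B.white B.black
    exact sided_or_sided_iff.2 ⟨(key _ wA _ wB).lt_of_ne (mul_ne_zero h1 h3),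
      (key _ bA _ wB).lt_of_ne (mul_ne_zero h1 h4), (key _ wA _ bB).lt_of_ne (mul_ne_zero h2 h3),
      (key _ bA _ bB).lt_of_ne (mul_ne_zero h2 h4)⟩

theorem sidedTotalOn_iff_not_pattern (hM : IsBRMatching F M) :
    SidedTotalOn M ↔ ∀ A ∈ M, ∀ B ∈ M, A ≠ B → ¬ A.PatternA B ∧ ¬ A.PatternB B := by
  constructor
  · intro h A hA B hB hAB
    exact ⟨not_patternA_of_comparable (h A hA B hB hAB),
      not_patternB_of_comparable (h A hA B hB hAB)⟩
  · intro h A hA B hB hAB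
    obtain ⟨h1, h2⟩ := hM.side_ne_zero hA hB hAB
    obtain ⟨h3, h4⟩ := hM.side_ne_zero hB hA hAB.symm
    exact comparable_of_not_pattern (hM.nonCrossing hA hB hAB) h1 h2 h3 h4 (h A hA B hB hAB).1
      (h B hB A hA hAB.symm).1 (h A hA B hB hAB).2 (h B hB A hA hAB.symm).2

end IsBRMatching

theorem sidedLinearOn_of_trans {S : Set BWSegment} (hS : SidedTotalOn S)
    (h : ∀ A ∈ S, ∀ B ∈ S, ∀ C ∈ S, A.Sided B → B.Sided C → A.Sided C) : SidedLinearOn S where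
  trichotomous A B h1 h2 := by
    by_contra hAB
    exact (hS A A.2 B B.2 fun h => hAB (Subtype.ext h)).elim h1 h2
  irrefl A := Sided.irrefl A.1
  trans A B C := h A A.2 B B.2 C C.2

theorem SidedTotalOn.mono {S T : Set BWSegment} (hT : SidedTotalOn T) (h : S ⊆ T) :
    SidedTotalOn S := fun A hA B hB => hT A (h hA) B (h hB)

/-- A total sidedness relation fails to be a linear order exactly if it has a cyclic triple. -/
theorem SidedTotalOn.not_sidedLinearOn_iff {M : Set BWSegment} (h : SidedTotalOn M) :
    ¬ SidedLinearOn M ↔ ∃ A ∈ M, ∃ B ∈ M, ∃ C ∈ M, IsCycle A B C := by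
  constructor
  · intro hlin
    by_contra! hno
    refine hlin (sidedLinearOn_of_trans h fun A hA B hB C hC hAB hBC => ?_)
    have hAC : A ≠ C := by
      rintro rfl
      exact hAB.asymm hBC
    exact (h A hA C hC hAC).resolve_right fun hCA => hno A hA B hB C hC ⟨hAB, hBC, hCA⟩
  · rintro ⟨A, hA, B, hB, C, hC, h1, h2, h3⟩ hlin
    exact h3.asymm (hlin.trans ⟨A, hA⟩ ⟨B, hB⟩ ⟨C, hC⟩ h1 h2)

theorem SidedTotalOn.not_sidedLinearOn_iff_threeStar {M : Set BWSegment} (h : SidedTotalOn M) :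
    ¬ SidedLinearOn M ↔ ∃ A ∈ M, ∃ B ∈ M, ∃ C ∈ M, A.ThreeStar B C := by
  rw [h.not_sidedLinearOn_iff]
  constructor
  · rintro ⟨A, hA, B, hB, C, hC, hcyc⟩
    exact ⟨A, hA, B, hB, C, hC, hcyc.threeStar⟩
  -- A line separating two segments that are comparable to its own segment is between them.
  have mid : ∀ X ∈ M, ∀ Y ∈ M, ∀ Z ∈ M, X.Separates Y Z →
      (Y.Sided X ∧ X.Sided Z) ∨ (Z.Sided X ∧ X.Sided Y) := by
    intro X hX Y hY Z hZ hsep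
    have hXY : X ≠ Y := by
      rintro rfl
      rcases hsep with hsep | hsep
      · exact hsep.1.1.ne' (orient_left _ _)
      · exact hsep.1.1.ne (orient_left _ _)
    have hXZ : X ≠ Z := by
      rintro rfl
      rcases hsep with hsep | hsep
      · exact hsep.2.1.ne (orient_left _ _)
      · exact hsep.2.1.ne' (orient_left _ _)
    rcases hsep with ⟨hs1, hs2⟩ | ⟨hs1, hs2⟩
    · exact Or.inl ⟨(h X hX Y hY hXY).resolve_left fun h' => lt_asymm hs1.1 h'.1.1,
        (h X hX Z hZ hXZ).resolve_right fun h' => lt_asymm hs2.1 h'.2.1⟩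
    · exact Or.inr ⟨(h X hX Z hZ hXZ).resolve_left fun h' => lt_asymm hs2.1 h'.1.1,
        (h X hX Y hY hXY).resolve_right fun h' => lt_asymm hs1.1 h'.2.1⟩
  rintro ⟨A, hA, B, hB, C, hC, -, hsA, hsB, hsC⟩
  rcases mid A hA B hB C hC hsA with ⟨h1, h2⟩ | ⟨h1, h2⟩
  · rcases mid B hB C hC A hA hsB with ⟨h3, h4⟩ | ⟨h3, h4⟩
    · exact ⟨B, hB, A, hA, C, hC, h1, h2, h3⟩
    · exact absurd h1 h3.asymm
  · rcases mid B hB C hC A hA hsB with ⟨h3, h4⟩ | ⟨h3, h4⟩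
    · exact absurd h2 (Sided.asymm h4)
    · exact ⟨A, hA, B, hB, C, hC, h2, h4, h1⟩

theorem SidedTotalOn.isLocallyTransitiveTournament {M : Set BWSegment} (h : SidedTotalOn M) :
    IsLocallyTransitiveTournament fun A B : M => A.1.Sided B.1 where
  asymm := Sided.asymm
  total {A B} hAB := h A A.2 B B.2 fun h => hAB (Subtype.ext h)
  not_sink h1 h2 h3 := IsCycle.not_sink ⟨h1, h2, h3⟩
  not_source h1 h2 h3 := IsCycle.not_source ⟨h1, h2, h3⟩

/-! ### The convex hull -/

/-- If the sidedness relation is linear, then both ends of its minimum are on the hull. -/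
theorem IsBRMatching.not_sidedLinearOn_of_hull {n : ℕ} (hn : 1 ≤ n) {F : BichromaticSet n}
    {M : Set BWSegment} (hM : IsBRMatching F M)
    (hull : F.points ∩ frontier (convexHull ℝ F.points) ⊆ F.white ∨
      F.points ∩ frontier (convexHull ℝ F.points) ⊆ F.black) : ¬ SidedLinearOn M := by
  intro hlin
  have := hM.finite
  have : IsStrictTotalOrder M fun A B => (A : BWSegment).Sided B := hlin
  have wf := Finite.wellFounded_of_trans_of_irrefl (fun A B : M => A.1.Sided B.1)
  obtain ⟨p, hp⟩ : F.white.Nonempty := by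
    rw [← Finset.card_pos, F.card_white]
    exact hn
  obtain ⟨X, ⟨hX, -⟩, -⟩ := hM.white_unique p hp
  obtain ⟨A, -, hA⟩ := wf.has_min Set.univ ⟨⟨X, hX⟩, trivial⟩
  have hside : ∀ y ∈ F.points, A.1.side y ≤ 0 := by
    intro y hy
    obtain ⟨B, hB, hyB⟩ := hM.exists_end hy
    by_cases hAB : A = ⟨B, hB⟩
    · subst hAB
      rcases hyB with rfl | rfl
      exacts [(orient_left _ _).le, (orient_right _ _).le]
    · have hlt : A.1.Sided B := by
        by_contra hno
        exact hAB (hlin.trichotomous A ⟨B, hB⟩ hno (hA ⟨B, hB⟩ trivial))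
      rcases hyB with rfl | rfl
      exacts [hlt.1.1.le, hlt.1.2.le]
  have hne := hM.white_ne_black A.2 A.2
  have hw := hM.white_mem_points A.2
  have hb := hM.black_mem_points A.2
  rcases hull with hull | hull
  · exact Finset.disjoint_left.1 F.disjoint (hull ⟨hb, mem_frontier_convexHull_of_orient_nonpos hne
      hside hb (orient_right _ _)⟩) (hM.black_mem A A.2)
  · exact Finset.disjoint_left.1 F.disjoint (hM.white_mem A A.2)
      (hull ⟨hw, mem_frontier_convexHull_of_orient_nonpos hne hside hw (orient_left _ _)⟩)

/-- Every segment `X` forms a cyclic triple with two consecutive segments of a given cyclic triple,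
so all these triples meet on rays of the same color, and no end of this color is on the hull. -/
theorem IsBRMatching.hull_of_isCycle {n : ℕ} {F : BichromaticSet n} {M : Set BWSegment}
    (hM : IsBRMatching F M) (ht : SidedTotalOn M) {A B C : BWSegment} (hA : A ∈ M) (hB : B ∈ M)
    (hC : C ∈ M) (h : IsCycle A B C) :
    F.points ∩ frontier (convexHull ℝ F.points) ⊆ F.white ∨
      F.points ∩ frontier (convexHull ℝ F.points) ⊆ F.black := by
  have hcyc := fun X : M => ht.isLocallyTransitiveTournament.exists_cycle (a := ⟨A, hA⟩)
    (b := ⟨B, hB⟩) (c := ⟨C, hC⟩) h.1 h.2.1 h.2.2 X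
  rcases h.turn_ne_zero.lt_or_gt with h0 | h0
  · have h1 := h.turn_neg_rotate h0
    have h2 := h.rotate.turn_neg_rotate h1
    right
    rintro p ⟨hp | hp, hfr⟩
    swap
    · exact hp
    obtain ⟨X, ⟨hX, rfl⟩, -⟩ := hM.white_unique p hp
    obtain ⟨P, Q, hXP, hPQ, hQX, heq⟩ := hcyc ⟨X, hX⟩
    have hXPQ : IsCycle X P Q := ⟨hXP, hPQ, hQX⟩
    have h3 : turn P.1 Q.1 < 0 := by
      rcases heq with ⟨rfl, rfl⟩ | ⟨rfl, rfl⟩ | ⟨rfl, rfl⟩ <;> assumption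
    have h4 := hXPQ.rotate.rotate.turn_neg_rotate (hXPQ.rotate.turn_neg_rotate h3)
    refine absurd (interior_mono (convexHull_mono ?_) (hXPQ.white_mem_interior h4)) hfr.2
    rintro x (rfl | rfl | rfl)
    exacts [hM.black_mem_points hX, hM.black_mem_points P.2, hM.black_mem_points Q.2]
  · have h1 := h.turn_pos_rotate h0
    have h2 := h.rotate.turn_pos_rotate h1
    left
    rintro p ⟨hp | hp, hfr⟩
    · exact hp
    obtain ⟨X, ⟨hX, rfl⟩, -⟩ := hM.black_unique p hp
    obtain ⟨P, Q, hXP, hPQ, hQX, heq⟩ := hcyc ⟨X, hX⟩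
    have hXPQ : IsCycle X P Q := ⟨hXP, hPQ, hQX⟩
    have h3 : 0 < turn P.1 Q.1 := by
      rcases heq with ⟨rfl, rfl⟩ | ⟨rfl, rfl⟩ | ⟨rfl, rfl⟩ <;> assumption
    have h4 := hXPQ.rotate.rotate.turn_pos_rotate (hXPQ.rotate.turn_pos_rotate h3)
    refine absurd (interior_mono (convexHull_mono ?_) (hXPQ.black_mem_interior h4)) hfr.2
    rintro x (rfl | rfl | rfl)
    exacts [hM.white_mem_points hX, hM.white_mem_points P.2, hM.white_mem_points Q.2]

/-! ### The glued circular order -/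

theorem SidedTotalOn.gluedBefore_iff {M : Set BWSegment} (h : SidedTotalOn M) (B X Y : M) :
    GluedBefore B X Y ↔ (X = B ∧ Y ≠ B) ∨
      CyclicallyOrdered (fun A B : M => A.1.Sided B.1) B X Y := by
  have h1 := @Sided.asymm B X
  have h2 := @Sided.asymm X Y
  have h3 := @Sided.asymm Y B
  by_cases hYB : Y = B
  · subst hYB
    simp only [GluedBefore, CyclicallyOrdered, Ne, Subtype.ext_iff]
    have := Sided.irrefl Y
    tauto
  by_cases hXB : X = B
  · subst hXB
    simp only [GluedBefore, CyclicallyOrdered, Ne, Subtype.ext_iff]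
    have := Sided.irrefl X
    rw [Subtype.ext_iff] at hYB
    tauto
  · have h4 := h Y Y.2 B B.2 fun h => hYB (Subtype.ext h)
    have h5 := h X X.2 B B.2 fun h => hXB (Subtype.ext h)
    rw [Subtype.ext_iff] at hXB
    simp only [GluedBefore, CyclicallyOrdered, Ne, Subtype.ext_iff]
    tauto

theorem SidedTotalOn.gluedBtw_iff {M : Set BWSegment} (h : SidedTotalOn M) (B X Y Z : M) :
    GluedBtw B X Y Z ↔ CyclicallyOrdered (fun A B : M => A.1.Sided B.1) X Y Z := by
  have T := h.isLocallyTransitiveTournament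
  simp only [GluedBtw, h.gluedBefore_iff]
  have rot : ∀ {a b c : M}, CyclicallyOrdered (fun A B : M => A.1.Sided B.1) a b c →
      CyclicallyOrdered (fun A B : M => A.1.Sided B.1) b c a := by
    intro a b c h1
    unfold CyclicallyOrdered at *
    tauto
  have as := @T.cyclicallyOrdered_asymm
  have tot := @T.cyclicallyOrdered_total
  have tr := @T.cyclicallyOrdered_trans
  have ne := @T.cyclicallyOrdered_ne
  generalize CyclicallyOrdered (fun A B : M => A.1.Sided B.1) = C at *
  grind

/-! ### Compatible matchings -/

namespace BWSegment

/-- `x` is one of the two ends of `A`. -/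
def IsEnd (A : BWSegment) (x : Plane) : Prop := x = A.white ∨ x = A.black

theorem IsEnd.side_eq_zero {A : BWSegment} {x : Plane} (h : A.IsEnd x) : A.side x = 0 := by
  rcases h with rfl | rfl
  exacts [orient_left _ _, orient_right _ _]

theorem IsEnd.side_neg {A B : BWSegment} {x : Plane} (h : B.IsEnd x) (hAB : A.Sided B) :
    A.side x < 0 := by
  rcases h with rfl | rfl
  exacts [hAB.1.1, hAB.1.2]

theorem IsEnd.side_pos {A B : BWSegment} {x : Plane} (h : B.IsEnd x) (hBA : B.Sided A) :
    0 < A.side x := by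
  rcases h with rfl | rfl
  exacts [hBA.2.1, hBA.2.2]

/-- The line of `A` separates two segments, one of which may have one end on the line and the other
one of which may be on the line. -/
theorem disjoint_openSegment_of_side {A : BWSegment} {x y z w : Plane}
    (h : 0 ≤ A.side x ∧ 0 ≤ A.side y ∧ (0 < A.side x ∨ 0 < A.side y) ∧
        A.side z ≤ 0 ∧ A.side w ≤ 0 ∨
      A.side x ≤ 0 ∧ A.side y ≤ 0 ∧ (A.side x < 0 ∨ A.side y < 0) ∧
        0 ≤ A.side z ∧ 0 ≤ A.side w) :
    Disjoint (openSegment ℝ x y) (openSegment ℝ z w) := by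
  refine Set.disjoint_left.2 fun v hv ⟨a, b, ha, hb, hab, hv'⟩ => ?_
  have e := orient_combo A.white A.black z w hab
  rw [hv'] at e
  rcases h with ⟨h1, h2, h3, h4, h5⟩ | ⟨h1, h2, h3, h4, h5⟩
  · have h6 := orient_pos_of_mem_openSegment h1 h2 h3 hv
    have := mul_nonneg ha.le (neg_nonneg.2 h4)
    have := mul_nonneg hb.le (neg_nonneg.2 h5)
    linarith
  · have h6 := orient_neg_of_mem_openSegment h1 h2 h3 hv
    have := mul_nonneg ha.le h4
    have := mul_nonneg hb.le h5
    linarith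

end BWSegment

section

variable {M : Set BWSegment}

/-- A segment from an end of `A` to an end of the successor of `A` crosses no segment `X` of the
matching. -/
theorem SidedTotalOn.disjoint_link_segment (h : SidedTotalOn M) {A B X : M}
    (hAB : IsSuccessor (fun A B : M => A.1.Sided B.1) A B) {x y : Plane} (hx : A.1.IsEnd x)
    (hy : B.1.IsEnd y) :
    Disjoint (openSegment ℝ x y) (openSegment ℝ X.1.white X.1.black) := by
  have hw : X.1.IsEnd X.1.white := Or.inl rfl
  have hb : X.1.IsEnd X.1.black := Or.inr rfl
  by_cases hXA : X = A
  · subst hXA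
    have h1 := hy.side_neg hAB.1
    exact disjoint_openSegment_of_side (Or.inr ⟨hx.side_eq_zero.le, h1.le, Or.inr h1,
      hw.side_eq_zero.ge, hb.side_eq_zero.ge⟩)
  by_cases hXB : X = B
  · subst hXB
    have h1 := hx.side_pos hAB.1
    exact disjoint_openSegment_of_side (Or.inl ⟨h1.le, hy.side_eq_zero.ge, Or.inl h1,
      hw.side_eq_zero.le, hb.side_eq_zero.le⟩)
  rcases h.isLocallyTransitiveTournament.isSuccessor_trichotomy hAB hXA hXB with
    ⟨h1, h2⟩ | ⟨h1, h2⟩ | ⟨h1, h2⟩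
  · exact disjoint_openSegment_of_side (Or.inl ⟨(hx.side_pos h1).le, (hy.side_pos h2).le,
      Or.inl (hx.side_pos h1), hw.side_eq_zero.le, hb.side_eq_zero.le⟩)
  · exact disjoint_openSegment_of_side (Or.inr ⟨(hx.side_neg h1).le, (hy.side_neg h2).le,
      Or.inl (hx.side_neg h1), hw.side_eq_zero.ge, hb.side_eq_zero.ge⟩)
  · have h3 := hy.side_neg hAB.1
    exact disjoint_openSegment_of_side (Or.inr ⟨hx.side_eq_zero.le, h3.le, Or.inr h3,
      (hw.side_pos h2).le, (hb.side_pos h2).le⟩)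

/-- Two segments that connect ends of different successor pairs do not cross. -/
theorem SidedTotalOn.disjoint_link_link (h : SidedTotalOn M) {A B C D : M}
    (hAB : IsSuccessor (fun A B : M => A.1.Sided B.1) A B)
    (hCD : IsSuccessor (fun A B : M => A.1.Sided B.1) C D) (hAC : A ≠ C) {x y z w : Plane}
    (hx : A.1.IsEnd x) (hy : B.1.IsEnd y) (hz : C.1.IsEnd z) (hw : D.1.IsEnd w) :
    Disjoint (openSegment ℝ x y) (openSegment ℝ z w) := by
  rcases h.isLocallyTransitiveTournament.isSuccessor_separated hAB hCD hAC with
    ⟨h1, h2⟩ | ⟨h1, h2⟩ | ⟨h1, h2⟩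
  · have h3 := hx.side_pos hAB.1
    refine disjoint_openSegment_of_side (Or.inl ⟨h3.le, hy.side_eq_zero.ge, Or.inl h3, ?_,
      (hw.side_neg h1).le⟩)
    rcases h2 with rfl | h2
    exacts [hz.side_eq_zero.le, (hz.side_neg h2).le]
  · have h3 := hy.side_neg hAB.1
    refine disjoint_openSegment_of_side (Or.inr ⟨hx.side_eq_zero.le, h3.le, Or.inr h3,
      (hz.side_pos h1).le, ?_⟩)
    rcases h2 with rfl | h2
    exacts [hw.side_eq_zero.ge, (hw.side_pos h2).le]
  · have h3 := hy.side_neg h1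
    refine disjoint_openSegment_of_side (Or.inr ⟨?_, h3.le, Or.inr h3, (hz.side_pos hCD.1).le,
      hw.side_eq_zero.ge⟩)
    rcases h2 with rfl | h2
    exacts [hx.side_eq_zero.le, (hx.side_neg h2).le]

/-- The matching that connects the white end of each `σ A` with the black end of `τ A`. -/
def linkMatching (σ τ : M ≃ M) : Set BWSegment :=
  Set.range fun A : M => ⟨(σ A).1.white, (τ A).1.black⟩

theorem IsBRMatching.isBRMatching_linkMatching {n : ℕ} {F : BichromaticSet n} (hM : IsBRMatching F M)
    (σ τ : M ≃ M) (h : NonCrossing (linkMatching σ τ)) : IsBRMatching F (linkMatching σ τ) where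
  white_mem := by
    rintro _ ⟨A, rfl⟩
    exact hM.white_mem (σ A).1 (σ A).2
  black_mem := by
    rintro _ ⟨A, rfl⟩
    exact hM.black_mem (τ A).1 (τ A).2
  white_unique := by
    intro p hp
    obtain ⟨X, ⟨hX, rfl⟩, -⟩ := hM.white_unique p hp
    refine ⟨_, ⟨⟨σ.symm ⟨X, hX⟩, rfl⟩, by simp⟩, ?_⟩
    rintro _ ⟨⟨A, rfl⟩, hA⟩
    obtain rfl : A = σ.symm ⟨X, hX⟩ := by
      rw [Equiv.eq_symm_apply]
      exact Subtype.ext (hM.eq_of_white_eq (σ A).2 hX hA)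
    rfl
  black_unique := by
    intro p hp
    obtain ⟨X, ⟨hX, rfl⟩, -⟩ := hM.black_unique p hp
    refine ⟨_, ⟨⟨τ.symm ⟨X, hX⟩, rfl⟩, by simp⟩, ?_⟩
    rintro _ ⟨⟨A, rfl⟩, hA⟩
    obtain rfl : A = τ.symm ⟨X, hX⟩ := by
      rw [Equiv.eq_symm_apply]
      exact Subtype.ext (hM.eq_of_black_eq (τ A).2 hX hA)
    rfl
  nonCrossing := h

theorem compatible_of_disjoint {M' : Set BWSegment} (h : NonCrossing M) (h' : NonCrossing M')
    (hd : ∀ X ∈ M', ∀ Y ∈ M, Disjoint (openSegment ℝ X.white X.black)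
      (openSegment ℝ Y.white Y.black)) : Compatible M M' := by
  rintro X (hX | hX) Y (hY | hY) hXY
  · exact h hX hY hXY
  · exact (hd Y hY X hX).symm
  · exact hd X hX Y hY
  · exact h' hX hY hXY

/-- Connecting every segment with its successor in the circular order in the two possible ways gives
two matchings that are compatible with the given one. -/
theorem IsBRMatching.exists_compatible {n : ℕ} {F : BichromaticSet n} (hM : IsBRMatching F M)
    (h : SidedTotalOn M) (hcyc : ∀ X : M, ∃ P Q : M, IsCycle X.1 P.1 Q.1) :
    ∃ M' M'' : Set BWSegment,
      IsBRMatching F M' ∧ IsBRMatching F M'' ∧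
      Disjoint M M' ∧ Disjoint M M'' ∧ Disjoint M' M'' ∧
      Compatible M M' ∧ Compatible M M'' := by
  have T := h.isLocallyTransitiveTournament
  have := hM.finite
  have hex : ∀ X : M, ∃ S : M, IsSuccessor (fun A B : M => A.1.Sided B.1) X S := fun X =>
    let ⟨_, _, hP⟩ := hcyc X
    T.exists_isSuccessor hP.1
  choose s hs using hex
  have hinj : Function.Injective s := fun A B hAB => T.isSuccessor_injective (hs A) (hAB ▸ hs B)
  set σ : M ≃ M := Equiv.ofBijective s (Finite.injective_iff_bijective.1 hinj)
  have hσ : ∀ A, IsSuccessor (fun A B : M => A.1.Sided B.1) A (σ A) := hs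
  have hne : ∀ A, σ A ≠ A := fun A => (T.ne (hσ A).1).symm
  have n₁ : NonCrossing (linkMatching (Equiv.refl M) σ) := by
    rintro _ ⟨A, rfl⟩ _ ⟨B, rfl⟩ hAB
    exact h.disjoint_link_link (hσ A) (hσ B) (fun h => hAB (by rw [h])) (Or.inl rfl) (Or.inr rfl)
      (Or.inl rfl) (Or.inr rfl)
  have n₂ : NonCrossing (linkMatching σ (Equiv.refl M)) := by
    rintro _ ⟨A, rfl⟩ _ ⟨B, rfl⟩ hAB
    simp only
    rw [openSegment_symm, openSegment_symm _ (σ B).1.white]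
    exact h.disjoint_link_link (hσ A) (hσ B) (fun h => hAB (by rw [h])) (Or.inr rfl) (Or.inl rfl)
      (Or.inr rfl) (Or.inl rfl)
  refine ⟨linkMatching (Equiv.refl M) σ, linkMatching σ (Equiv.refl M),
    hM.isBRMatching_linkMatching _ _ n₁, hM.isBRMatching_linkMatching _ _ n₂, ?_, ?_, ?_, ?_, ?_⟩
  · refine Set.disjoint_left.2 ?_
    rintro _ hX ⟨A, rfl⟩
    have h1 := hM.eq_of_white_eq hX A.2 rfl
    have h2 := hM.eq_of_black_eq hX (σ A).2 rfl
    exact hne A (Subtype.ext (h2.symm.trans h1))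
  · refine Set.disjoint_left.2 ?_
    rintro _ hX ⟨A, rfl⟩
    have h1 := hM.eq_of_white_eq hX (σ A).2 rfl
    have h2 := hM.eq_of_black_eq hX A.2 rfl
    exact hne A (Subtype.ext (h1.symm.trans h2))
  · refine Set.disjoint_left.2 ?_
    rintro _ ⟨A, rfl⟩ ⟨B, hB⟩
    rw [BWSegment.mk.injEq] at hB
    have h1 : σ B = A := Subtype.ext (hM.eq_of_white_eq (σ B).2 A.2 hB.1)
    have h2 : B = σ A := Subtype.ext (hM.eq_of_black_eq B.2 (σ A).2 hB.2)
    have h3 := (hσ B).1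
    rw [h1, h2] at h3
    exact T.asymm (hσ A).1 h3
  · refine compatible_of_disjoint hM.nonCrossing n₁ ?_
    rintro _ ⟨A, rfl⟩ Y hY
    exact h.disjoint_link_segment (X := ⟨Y, hY⟩) (hσ A) (Or.inl rfl) (Or.inr rfl)
  · refine compatible_of_disjoint hM.nonCrossing n₂ ?_
    rintro _ ⟨A, rfl⟩ Y hY
    simp only
    rw [openSegment_symm]
    exact h.disjoint_link_segment (X := ⟨Y, hY⟩) (hσ A) (Or.inr rfl) (Or.inl rfl)

end

/-! ### Circular matchings -/

theorem IsBRMatching.isCircularMatching_iff {n : ℕ} (hn : 1 ≤ n) {F : BichromaticSet n}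
    {M : Set BWSegment} (hM : IsBRMatching F M) :
    IsCircularMatching F M ↔ SidedTotalOn M ∧ ¬ SidedLinearOn M := by
  rw [IsCircularMatching, ← hM.sidedTotalOn_iff_not_hasChromaticCut]
  constructor
  · rintro ⟨-, h, hull⟩
    exact ⟨h, hM.not_sidedLinearOn_of_hull hn hull⟩
  · rintro ⟨h, hlin⟩
    obtain ⟨A, hA, B, hB, C, hC, hcyc⟩ := h.not_sidedLinearOn_iff.1 hlin
    exact ⟨hM, h, hM.hull_of_isCycle h hA hB hC hcyc⟩

theorem theorem3 (n : ℕ) (hn : 1 ≤ n) (F : BichromaticSet n) (M : Set BWSegment)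
    (hM : IsBRMatching F M) :
    -- the three equivalent conditions
    List.TFAE [
      IsCircularMatching F M,
      SidedTotalOn M ∧ ¬ SidedLinearOn M,
      (∀ A ∈ M, ∀ B ∈ M, A ≠ B → ¬ A.PatternA B ∧ ¬ A.PatternB B) ∧
        ∃ A ∈ M, ∃ B ∈ M, ∃ C ∈ M, A.ThreeStar B C] ∧
    (IsCircularMatching F M →
      -- for every base segment the gluing of the two linear orders makes sense
      (∀ B ∈ M,
        (leftPart M B).Nonempty ∧ (rightPart M B).Nonempty ∧
        SidedLinearOn (leftPart M B ∪ {B}) ∧ SidedLinearOn (rightPart M B) ∧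
        ∀ Z A, IsSidedMax (rightPart M B) Z → IsSidedMin (leftPart M B) A → Z.Sided A) ∧
      -- it yields a circular order on `M`, the same one for all base segments
      (∃ c : CircularOrder M, ∀ B ∈ M, ∀ X Y Z : M, c.sbtw X Y Z ↔ GluedBtw B X Y Z) ∧
      -- two further matchings
      ∃ M' M'' : Set BWSegment,
        IsBRMatching F M' ∧ IsBRMatching F M'' ∧
        Disjoint M M' ∧ Disjoint M M'' ∧ Disjoint M' M'' ∧
        Compatible M M' ∧ Compatible M M'') := by
  refine ⟨?_, fun hc => ?_⟩
  · tfae_have 1 ↔ 2 := hM.isCircularMatching_iff hn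
    tfae_have 2 ↔ 3 := by
      rw [← hM.sidedTotalOn_iff_not_pattern]
      exact and_congr_right fun h => h.not_sidedLinearOn_iff_threeStar
    tfae_finish
  obtain ⟨h, hlin⟩ := (hM.isCircularMatching_iff hn).1 hc
  have T := h.isLocallyTransitiveTournament
  obtain ⟨A, hA, B, hB, C, hC, h1, h2, h3⟩ := h.not_sidedLinearOn_iff.1 hlin
  have hcyc : ∀ X : M, ∃ P Q : M, IsCycle X.1 P.1 Q.1 := by
    intro X
    obtain ⟨P, Q, hXP, hPQ, hQX, -⟩ :=
      T.exists_cycle (a := ⟨A, hA⟩) (b := ⟨B, hB⟩) (c := ⟨C, hC⟩) h1 h2 h3 X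
    exact ⟨P, Q, hXP, hPQ, hQX⟩
  refine ⟨fun B hB => ?_, ⟨T.circularOrder, fun B hB X Y Z => (h.gluedBtw_iff ⟨B, hB⟩ X Y Z).symm⟩,
    hM.exists_compatible h hcyc⟩
  obtain ⟨P, Q, hBP, hPQ, hQB⟩ := hcyc ⟨B, hB⟩
  refine ⟨⟨Q, Q.2, hQB⟩, ⟨P, P.2, hBP⟩, ?_, ?_, ?_⟩
  · refine sidedLinearOn_of_trans (h.mono ?_) ?_
    · rintro X (hX | rfl)
      exacts [hX.1, hB]
    · rintro X (hX | rfl) Y (hY | rfl) Z (hZ | rfl) hXY hYZ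
      · exact T.trans_in (x := ⟨B, hB⟩) (a := ⟨X, hX.1⟩) (b := ⟨Y, hY.1⟩) (c := ⟨Z, hZ.1⟩)
          hX.2 hY.2 hZ.2 hXY hYZ
      · exact hX.2
      · exact absurd hYZ hZ.2.asymm
      · exact absurd hYZ (Sided.irrefl _)
      · exact absurd hXY hY.2.asymm
      · exact absurd hXY hY.2.asymm
      · exact absurd hXY (Sided.irrefl _)
      · exact hXY
  · exact sidedLinearOn_of_trans (h.mono fun X hX => hX.1) fun X hX Y hY Z hZ hXY hYZ =>
      T.trans_out (x := ⟨B, hB⟩) (a := ⟨X, hX.1⟩) (b := ⟨Y, hY.1⟩) (c := ⟨Z, hZ.1⟩)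
        hX.2 hY.2 hZ.2 hXY hYZ
  · rintro Z A ⟨hZ, hZmax⟩ ⟨hA, hAmin⟩
    exact T.max_out_rel_min_in (x := ⟨B, hB⟩) (z := ⟨Z, hZ.1⟩) (a := ⟨A, hA.1⟩) hBP hPQ hQB hZ.2
      (fun Y hY hne => hZmax Y ⟨Y.2, hY⟩ fun h => hne (Subtype.ext h)) hA.2
      (fun Y hY hne => hAmin Y ⟨Y.2, hY⟩ fun h => hne (Subtype.ext h))
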